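/- Let $(A,B,D)$ be a random vector with values in $(0,\infty)\times\mathbb R^2$, let $(A_n,B_n,D_n)_{n\ge 1}$ be i.i.d. copies of it, and let $(V_n)$ be the Markov chain $V_n=A_n\max(D_n,V_{n-1})+B_n$ (Letac's Model E), with transition kernel $P$. Put $\Lambda(\alpha)=\log \mathbf E[A^\alpha]$ and assume: * $(H_1)$ the law of $A$ has a non-zero absolutely continuous component with respect to Lebesgue measure, and $\Lambda(\xi)=0$ for some $\xi\in(0,\infty)$ such that $\Lambda$ is finite in a neighbourhood of $\xi$; * $(H_2)$ $\mathbf E[|B|^\xi]<\infty$ and $\mathbf E[(A|D|)^\xi]<\infty$; * $(H_3)$ $\mathbf P(A>1,B>0)>0$ or $\mathbf P(A>1,B\ge 0,D>0)>0$. Let the regeneration structure of the chain be given by any one-step minorization $\delta\,\mathbf 1_{\mathcal C}(x)\,\nu(E)\le P(x,E)$ (for all $x\in\mathbb R$ and Borel $E$), where $\delta\in(0,1]$, $\nu$ is a probability measure, and $\mathcal C$ is a bounded Borel set with $\varphi(\mathcal C)>0$ for an irreducibility measure $\varphi$ of $(V_n)$. That is, in the split chain $(V_n,\eta_n)$ the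 variable $\eta_n$ is Bernoulli($\delta$) and independent of the past and of $V_n$; given the past, $V_n$ and $\eta_n$, the variable $V_{n+1}$ has law $P(V_n,\cdot)$ if $V_n\notin\mathcal C$, law $\nu$ if $V_n\in\mathcal C$ and $\eta_n=1$, and law $(P(V_n,\cdot)-\delta\nu)/(1-\delta)$ if $V_n\in\mathcal C$ and $\eta_n=0$. The regeneration time is $\tau=1+\inf\{n\ge 0: V_n\in\mathcal C,\ \eta_n=1\}\in\{1,2,\dots\}\cup\{\infty\}$. Let $$N_u=\sum_{n=0}^{\tau-1}\mathbf 1_{(u,\infty)}(V_n),\qquad U(z)=\sum_{n=0}^\infty \mu_A^{\star n}(-\infty,z),$$ where $\mu_A$ is the law of $-\log A$ and $\mu_A^{\star 0}$ is the unit mass at $0$. **Theorem 4.1.** For every $v>1$ such that $\log v$ is not an atom of any $\mu_A^{\star n}$, $n\ge 0$ (every $v>1$ outside a countable set; every $v>1$ if the law of $A$ has no atoms), $U(\log v)<\infty$ and $$\lim_{u\to\infty}\mathbf E\Big[N_u\,\Big|\,\frac{V_0}{u}=v\Big]=U(\log v).$$ -/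

import Mathlib

open MeasureTheory ProbabilityTheory Filter Topology
open scoped ENNReal NNReal unitInterval

noncomputable section

namespace LetacE

/-! The driving variable is `Y = (A, B, D)`.  It enters through its law `μ` on `ℝ × ℝ × ℝ`, so
`y.1`, `y.2.1` and `y.2.2` are the values of `A`, `B` and `D`. -/

/-- The random map `F_Y(v) = A max(D, v) + B`. -/
def letacMap (y : ℝ × ℝ × ℝ) (v : ℝ) : ℝ := y.1 * max y.2.2 v + y.2.1

lemma measurable_letacMap : Measurable fun p : ℝ × (ℝ × ℝ × ℝ) => letacMap p.2 p.1 := by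
  unfold letacMap
  fun_prop

/-- The transition kernel `P(v, ·) = law of F_Y(v)` of the Markov chain given by the forward
recursion `V_n = A_n max(D_n, V_{n-1}) + B_n` with i.i.d. `(A_n, B_n, D_n)` of law `μ`. -/
def letacKernel (μ : Measure (ℝ × ℝ × ℝ)) [IsProbabilityMeasure μ] : Kernel ℝ ℝ where
  toFun v := μ.map fun y => letacMap y v
  measurable' := by
    refine Measure.measurable_of_measurable_coe _ fun s hs => ?_
    have h : ∀ v : ℝ, (μ.map fun y => letacMap y v) s
        = μ (Prod.mk v ⁻¹' ((fun p : ℝ × (ℝ × ℝ × ℝ) => letacMap p.2 p.1) ⁻¹' s)) := fun v => by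
      have hv : Measurable fun y => letacMap y v := measurable_letacMap.comp measurable_prodMk_left
      rw [Measure.map_apply hv hs]
      rfl
    simp_rw [h]
    exact measurable_measure_prodMk_left (measurable_letacMap hs)

instance (μ : Measure (ℝ × ℝ × ℝ)) [IsProbabilityMeasure μ] :
    IsMarkovKernel (letacKernel μ) :=
  ⟨fun _ => Measure.isProbabilityMeasure_map
    (measurable_letacMap.comp measurable_prodMk_left).aemeasurable⟩

/-- `Λ(α) = log E[A ^ α]`. -/
def logMoment (μ : Measure (ℝ × ℝ × ℝ)) (α : ℝ) : ℝ := Real.log (∫ y, y.1 ^ α ∂μ)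

/-- `(H₁)` with exponent `ξ`: the law of `A` is not singular to Lebesgue measure, `ξ > 0`, the
function `Λ` is finite in a neighbourhood of `ξ` (this is the interior of its domain, where the
convex function `Λ` is differentiable), and `Λ(ξ) = 0`. -/
structure H1 (μ : Measure (ℝ × ℝ × ℝ)) (ξ : ℝ) : Prop where
  not_singular : ¬ (μ.map fun y => y.1).MutuallySingular volume
  pos : 0 < ξ
  finite_near : ∀ᶠ α in 𝓝 ξ, Integrable (fun y => y.1 ^ α) μ
  root : logMoment μ ξ = 0

/-- `(H₂)`: `E[|B| ^ ξ] < ∞` and `E[(A |D|) ^ ξ] < ∞`. -/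
structure H2 (μ : Measure (ℝ × ℝ × ℝ)) (ξ : ℝ) : Prop where
  integrable_B : Integrable (fun y => |y.2.1| ^ ξ) μ
  integrable_AD : Integrable (fun y => (y.1 * |y.2.2|) ^ ξ) μ

/-- `(H₃)`: `P(A > 1, B > 0) > 0` or `P(A > 1, B ≥ 0, D > 0) > 0`. -/
def H3 (μ : Measure (ℝ × ℝ × ℝ)) : Prop :=
  0 < μ {y | 1 < y.1 ∧ 0 < y.2.1} ∨ 0 < μ {y | 1 < y.1 ∧ 0 ≤ y.2.1 ∧ 0 < y.2.2}

/-- A one-step minorization `δ 1_C(x) ν(E) ≤ P(x, E)` of a Markov chain on `ℝ` with transition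
kernel `P`, with a bounded set `C` that is charged by an irreducibility measure `φ` of the chain
(equivalently, by a maximal one). -/
structure Minorization (P : Kernel ℝ ℝ) where
  C : Set ℝ
  δ : I
  ν : Measure ℝ
  measurableSet_C : MeasurableSet C
  bounded_C : Bornology.IsBounded C
  δ_pos : 0 < δ
  prob_ν : IsProbabilityMeasure ν
  charged_C : ∃ φ : Measure ℝ, P.IsIrreducible φ ∧ 0 < φ C
  minor : ∀ x ∈ C, ∀ E : Set ℝ, MeasurableSet E → ENNReal.ofReal δ * ν E ≤ P x E

namespace Minorization

variable {P : Kernel ℝ ℝ} (R : Minorization P)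

/-- The residual law `(P(x, ·) - δ ν) / (1 - δ)`, used for `x ∈ C` when `δ < 1`. -/
def residual (x : ℝ) : Measure ℝ :=
  (ENNReal.ofReal (1 - R.δ))⁻¹ • (P x - ENNReal.ofReal R.δ • R.ν)

open Classical in
/-- The law of `V_{n+1}` given `V_n = x` and `η_n = b` in the split chain: off `C` it is `P(x, ·)`;
on `C` it is `ν` if `η_n = 1` and the residual law if `η_n = 0`.  (For `δ = 1` the case `η_n = 0`
has probability zero, and `P(x, ·)` is then only a default value.) -/
def splitLaw (s : ℝ × Bool) : Measure ℝ :=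
  if s.1 ∈ R.C then
    if s.2 = true then R.ν else if (R.δ : ℝ) < 1 then R.residual s.1 else P s.1
  else P s.1

lemma smul_le {x : ℝ} (hx : x ∈ R.C) : ENNReal.ofReal R.δ • R.ν ≤ P x :=
  Measure.le_iff.2 fun E hE => by simpa using R.minor x hx E hE

lemma residual_apply {x : ℝ} (hx : x ∈ R.C) {E : Set ℝ} (hE : MeasurableSet E) :
    R.residual x E
      = (ENNReal.ofReal (1 - R.δ))⁻¹ * (P x E - ENNReal.ofReal R.δ * R.ν E) := by
  have := R.prob_ν
  have : IsFiniteMeasure (ENNReal.ofReal R.δ • R.ν) :=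
    R.ν.smul_finite ENNReal.ofReal_ne_top
  simp [residual, Measure.sub_apply hE (R.smul_le hx)]

lemma measurable_splitLaw : Measurable R.splitLaw := by
  classical
  refine Measure.measurable_of_measurable_coe _ fun E hE => ?_
  have hP : Measurable fun s : ℝ × Bool => P s.1 E :=
    (P.measurable_coe hE).comp measurable_fst
  have hC : MeasurableSet {s : ℝ × Bool | s.1 ∈ R.C} := measurable_fst R.measurableSet_C
  have hb : MeasurableSet {s : ℝ × Bool | s.2 = true} :=
    measurable_snd (measurableSet_singleton true)
  have key : (fun s : ℝ × Bool => R.splitLaw s E) = fun s =>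
      if s.1 ∈ R.C then
        if s.2 = true then R.ν E
        else if (R.δ : ℝ) < 1 then
          (ENNReal.ofReal (1 - R.δ))⁻¹ * (P s.1 E - ENNReal.ofReal R.δ * R.ν E)
        else P s.1 E
      else P s.1 E := by
    funext s
    unfold splitLaw
    split_ifs with h
    · rfl
    · exact R.residual_apply h hE
    · rfl
    · rfl
  rw [key]
  refine Measurable.ite hC (Measurable.ite hb measurable_const ?_) hP
  split_ifs
  · exact (hP.sub measurable_const).const_mul _
  · exact hP

/-- The transition kernel of the split chain `(V_n, η_n)`: given `(V_n, η_n)`, the variable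
`V_{n+1}` has law `splitLaw (V_n, η_n)`, and `η_{n+1}` is an independent Bernoulli variable
with success probability `δ`. -/
def splitKernel : Kernel (ℝ × Bool) (ℝ × Bool) :=
  Kernel.prod ⟨R.splitLaw, R.measurable_splitLaw⟩ (Kernel.const _ (bernoulliMeasure true false R.δ))

instance [IsMarkovKernel P] : IsMarkovKernel R.splitKernel := by
  have hν := R.prob_ν
  have : IsMarkovKernel (⟨R.splitLaw, R.measurable_splitLaw⟩ : Kernel (ℝ × Bool) ℝ) := by
    refine ⟨fun s => ⟨?_⟩⟩
    change R.splitLaw s Set.univ = 1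
    unfold splitLaw
    split_ifs with h _ hδ
    · exact measure_univ
    · rw [R.residual_apply h MeasurableSet.univ, measure_univ, measure_univ, mul_one,
        ← ENNReal.ofReal_one, ← ENNReal.ofReal_sub _ R.δ.2.1]
      have h0 : 0 < 1 - (R.δ : ℝ) := sub_pos.2 hδ
      exact (ENNReal.inv_mul_cancel (ENNReal.ofReal_pos.2 h0).ne' ENNReal.ofReal_ne_top).trans
        ENNReal.ofReal_one.symm
    · exact measure_univ
    · exact measure_univ
  unfold splitKernel
  infer_instance

/-- The law of the trajectory `((V_n, η_n))_{n ≥ 0}` of the split chain started at `V_0 = x`. -/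
def pathLaw [IsMarkovKernel P] (x : ℝ) : Measure (ℕ → ℝ × Bool) :=
  Kernel.trajMeasure (X := fun _ => ℝ × Bool)
    ((Measure.dirac x).prod (bernoulliMeasure true false R.δ))
    fun n => R.splitKernel.comap
      (fun h : (i : Finset.Iic n) → ℝ × Bool => h ⟨n, Finset.mem_Iic.2 le_rfl⟩)
      (measurable_pi_apply _)

/-- The regeneration time: `τ - 1` is the first `k ≥ 0` with `(V_k, η_k) ∈ C × {1}`, and `τ = ∞`
if there is no such `k`. -/
def regenTime (ω : ℕ → ℝ × Bool) : ℕ∞ :=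
  ⨅ (k : ℕ) (_ : (ω k).1 ∈ R.C ∧ (ω k).2 = true), ((k + 1 : ℕ) : ℕ∞)

open Classical in
/-- `N_u = ∑_{n=0}^{τ-1} 1_{(u,∞)}(V_n)`. -/
def exceedances (u : ℝ) (ω : ℕ → ℝ × Bool) : ℝ≥0∞ :=
  ∑' n : ℕ, if (n : ℕ∞) < R.regenTime ω ∧ u < (ω n).1 then 1 else 0

/-- `E[N_u | V_0 = x]`. -/
def meanExceedances [IsMarkovKernel P] (u x : ℝ) : ℝ≥0∞ :=
  ∫⁻ ω, R.exceedances u ω ∂(R.pathLaw x)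

end Minorization

/-- `μ_A`, the law of `-log A`. -/
def negLogLaw (μ : Measure (ℝ × ℝ × ℝ)) : Measure ℝ := μ.map fun y => -Real.log y.1

/-- The convolution powers `m^{⋆n}`, with `m^{⋆0}` the unit mass at `0`. -/
def convPow (m : Measure ℝ) : ℕ → Measure ℝ
  | 0 => Measure.dirac 0
  | n + 1 => (convPow m n).conv m

/-- `U(z) = ∑_{n ≥ 0} μ_A^{⋆n}(-∞, z)`. -/
def renewalU (μ : Measure (ℝ × ℝ × ℝ)) (z : ℝ) : ℝ≥0∞ :=
  ∑' n : ℕ, convPow (negLogLaw μ) n (Set.Iio z)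

end LetacE

end

namespace LetacE

/-! ### Powers of a kernel. -/

section KernelPowers

variable {X : Type*} [MeasurableSpace X] (κ : Kernel X X)

/-! Let `K = P - δ 1_C ⊗ ν` be the kernel of the chain killed at regeneration (`killed`). Averaging
the split chain over `η_n` on the event that no regeneration has yet occurred gives `E[N_u | V_0 =
x] = ∑ K^n(x, (u,∞))` (`meanExceedances_eq`). The theorem is then a passage to the limit in a
series.

For fixed `n`, the terms `D` and `B` are negligible when the chain starts at `vu`, so `P^n(vu,
(u,∞))` tends to the probability that `v A_1 ⋯ A_n > 1`, which is `μ_A^{⋆n}(-∞, log v)`. The bounded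
set `C` is not met within `n` steps in the limit, so `K^n` has the same limit
(`tendsto_killed_pow_Ioi`).

For domination, take `0 < α < ξ` with `α ≤ 1`. Then `β = E[A^α] < 1` by strict concavity, and
Markov's inequality bounds the `n`-th term by `v^α β^n` plus `u^(-α)` times a contribution of `B`
and `D` (`killed_pow_Ioi_le`). Summed over `n`, this contribution is at most a constant times the
mean regeneration time from `vu`. A drift argument with exponent `α/2` bounds that time by
`(vu)^(α/2) + c`, so the total error vanishes.

The drift argument needs `C` to be reached with a uniform lower bound from every bounded set
(`exists_le_hitSum`), although `C` is charged only by an arbitrary irreducibility measure. Two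
regimes cover this. If the chain from `M` can fall to a point that `D` exceeds with positive
probability, the next value can be `A D + B`, which forgets the past, and monotonicity extends this
to all starting points below `M`. Otherwise the chain is affine above `M`. Baire's theorem and the
weak Feller property give a dense open set of points with locally uniform access to `C`; its
complement is closed and absorbing. Were that complement nonempty, its part in the affine region
would be unbounded above and invariant under affine maps whose slopes have ratios arbitrarily close
to `1`, and so would meet every open set above the fixed point of a contraction among them, which
contradicts density. -/

lemma lintegral_pow_zero (x : X) {g : X → ℝ≥0∞} (hg : Measurable g) :
    ∫⁻ y, g y ∂((κ ^ 0) x) = g x := by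
  rw [pow_zero]
  change ∫⁻ y, g y ∂(Kernel.id x) = g x
  rw [Kernel.id_apply, lintegral_dirac' _ hg]

lemma pow_zero_apply (x : X) {E : Set X} (hE : MeasurableSet E) :
    (κ ^ 0) x E = E.indicator 1 x := by
  rw [pow_zero]
  change Kernel.id x E = _
  rw [Kernel.id_apply, Measure.dirac_apply' _ hE]

lemma lintegral_pow_succ (n : ℕ) (x : X) {g : X → ℝ≥0∞} (hg : Measurable g) :
    ∫⁻ y, g y ∂((κ ^ (n + 1)) x) = ∫⁻ y, ∫⁻ z, g z ∂((κ ^ n) y) ∂(κ x) := by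
  rw [pow_succ]
  exact Kernel.lintegral_comp _ _ _ hg

lemma lintegral_pow_succ' (n : ℕ) (x : X) {g : X → ℝ≥0∞} (hg : Measurable g) :
    ∫⁻ y, g y ∂((κ ^ (n + 1)) x) = ∫⁻ y, ∫⁻ z, g z ∂(κ y) ∂((κ ^ n) x) := by
  rw [pow_succ']
  exact Kernel.lintegral_comp _ _ _ hg

lemma pow_add_apply (m n : ℕ) (x : X) {E : Set X} (hE : MeasurableSet E) :
    (κ ^ (m + n)) x E = ∫⁻ y, (κ ^ n) y E ∂((κ ^ m) x) :=
  Kernel.pow_add_apply_eq_lintegral κ m n x hE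

instance isMarkovKernel_pow [IsMarkovKernel κ] (n : ℕ) : IsMarkovKernel (κ ^ n) := by
  induction n with
  | zero => rw [pow_zero]; change IsMarkovKernel (Kernel.id : Kernel X X); infer_instance
  | succ n ih => rw [pow_succ]; change IsMarkovKernel (_ ∘ₖ _); infer_instance

end KernelPowers

/-! ### Weak Feller property, monotonicity and absorbing sets of Letac's kernel. -/

section Basic

lemma measurable_letacMap_left (x : ℝ) : Measurable fun y => letacMap y x :=
  measurable_letacMap.comp measurable_prodMk_left

lemma continuous_letacMap (y : ℝ × ℝ × ℝ) : Continuous (letacMap y) := by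
  unfold letacMap; fun_prop

/-- The weak Feller property in the form used below: Fatou's lemma along a sequence, since each
random map is continuous. -/
lemma lowerSemicontinuous_lintegral_letacMap {μ : Measure (ℝ × ℝ × ℝ)} {g : ℝ → ℝ≥0∞}
    (hg : LowerSemicontinuous g) :
    LowerSemicontinuous fun x => ∫⁻ y, g (letacMap y x) ∂μ := by
  intro x c hc
  by_contra hcon
  obtain ⟨s, hs, hsc⟩ := exists_seq_forall_of_frequently (not_eventually.1 hcon)
  refine absurd hc (not_lt.2 ?_)
  calc ∫⁻ y, g (letacMap y x) ∂μ
      ≤ ∫⁻ y, liminf (fun n => g (letacMap y (s n))) atTop ∂μ := by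
        refine lintegral_mono fun y => ?_
        have h1 := (hg.comp (continuous_letacMap y)) x
        refine le_of_forall_lt fun b hb => ?_
        obtain ⟨b', hb, hb'⟩ := exists_between hb
        refine hb.trans_le (le_liminf_of_le (by isBoundedDefault) ?_)
        filter_upwards [hs.eventually (h1 b' hb')] with n hn using hn.le
    _ ≤ liminf (fun n => ∫⁻ y, g (letacMap y (s n)) ∂μ) atTop :=
        lintegral_liminf_le fun n => hg.measurable.comp (measurable_letacMap_left _)
    _ ≤ c := by
        refine liminf_le_of_frequently_le' (Frequently.of_forall fun n => ?_)
        exact not_lt.1 (hsc n)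

variable {μ : Measure (ℝ × ℝ × ℝ)} [IsProbabilityMeasure μ]

lemma lintegral_letacKernel (x : ℝ) {g : ℝ → ℝ≥0∞} (hg : Measurable g) :
    ∫⁻ z, g z ∂(letacKernel μ x) = ∫⁻ y, g (letacMap y x) ∂μ :=
  lintegral_map hg (measurable_letacMap_left x)

lemma letacKernel_apply (x : ℝ) {E : Set ℝ} (hE : MeasurableSet E) :
    letacKernel μ x E = μ {y | letacMap y x ∈ E} :=
  Measure.map_apply (measurable_letacMap_left x) hE

lemma lintegral_letacKernel_pow_succ (n : ℕ) (x : ℝ) {g : ℝ → ℝ≥0∞} (hg : Measurable g) :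
    ∫⁻ z, g z ∂((letacKernel μ ^ (n + 1)) x)
      = ∫⁻ y, ∫⁻ z, g z ∂((letacKernel μ ^ n) (letacMap y x)) ∂μ := by
  rw [lintegral_pow_succ _ _ _ hg]
  exact lintegral_letacKernel x hg.lintegral_kernel

lemma letacKernel_pow_succ_apply (n : ℕ) (x : ℝ) {E : Set ℝ} (hE : MeasurableSet E) :
    (letacKernel μ ^ (n + 1)) x E = ∫⁻ y, (letacKernel μ ^ n) (letacMap y x) E ∂μ := by
  rw [add_comm, pow_add_apply _ _ _ _ hE, pow_one]
  exact lintegral_letacKernel x (Kernel.measurable_coe _ hE)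

lemma letacKernel_pow_succ_apply_eq_zero (n : ℕ) (x : ℝ) {E : Set ℝ} (hE : MeasurableSet E) :
    (letacKernel μ ^ (n + 1)) x E = 0 ↔ ∀ᵐ y ∂μ, (letacKernel μ ^ n) (letacMap y x) E = 0 := by
  rw [letacKernel_pow_succ_apply _ _ hE]
  exact lintegral_eq_zero_iff ((Kernel.measurable_coe _ hE).comp (measurable_letacMap_left x))

lemma letacMap_mono {y : ℝ × ℝ × ℝ} (hy : 0 < y.1) : Monotone (letacMap y) := by
  intro a b hab
  unfold letacMap
  gcongr

lemma antitone_lintegral_letacKernel_pow (hA : ∀ᵐ y ∂μ, 0 < y.1) (n : ℕ) {g : ℝ → ℝ≥0∞}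
    (hg : Measurable g) (hg' : Antitone g) :
    Antitone fun x => ∫⁻ z, g z ∂((letacKernel μ ^ n) x) := by
  induction n with
  | zero => simpa only [lintegral_pow_zero _ _ hg] using hg'
  | succ n ih =>
    intro a b hab
    simp only [lintegral_letacKernel_pow_succ _ _ hg]
    refine lintegral_mono_ae ?_
    filter_upwards [hA] with y hy
    exact ih (letacMap_mono hy hab)

lemma antitone_letacKernel_pow_apply (hA : ∀ᵐ y ∂μ, 0 < y.1) (n : ℕ) {E : Set ℝ}
    (hE : MeasurableSet E) (hE' : IsLowerSet E) :
    Antitone fun x => (letacKernel μ ^ n) x E := by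
  have h := antitone_lintegral_letacKernel_pow hA n (g := E.indicator 1)
    (measurable_one.indicator hE) ?_
  · simpa only [lintegral_indicator_one hE] using h
  · intro a b hab
    by_cases hb : b ∈ E
    · simp [hb, hE' hab hb]
    · simp [hb]

lemma lowerSemicontinuous_letacKernel_pow (n : ℕ) {O : Set ℝ} (hO : IsOpen O) :
    LowerSemicontinuous fun x => (letacKernel μ ^ n) x O := by
  induction n with
  | zero =>
    simp only [pow_zero_apply _ _ hO.measurableSet]
    exact hO.lowerSemicontinuous_indicator zero_le_one
  | succ n ih =>
    simp only [letacKernel_pow_succ_apply _ _ hO.measurableSet]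
    exact lowerSemicontinuous_lintegral_letacMap ih

/-- The points from which the chain never enters `E`. -/
def avoid (μ : Measure (ℝ × ℝ × ℝ)) [IsProbabilityMeasure μ] (E : Set ℝ) : Set ℝ :=
  {x | ∀ n, (letacKernel μ ^ n) x E = 0}

lemma isClosed_avoid {O : Set ℝ} (hO : IsOpen O) : IsClosed (avoid μ O) := by
  have : avoid μ O = ⋂ n, (fun x => (letacKernel μ ^ n) x O) ⁻¹' Set.Iic 0 := by
    ext x; simp [avoid]
  rw [this]
  exact isClosed_iInter fun n => (lowerSemicontinuous_letacKernel_pow n hO).isClosed_preimage 0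

lemma ae_letacMap_mem_avoid {E : Set ℝ} (hE : MeasurableSet E) {x : ℝ} (hx : x ∈ avoid μ E) :
    ∀ᵐ y ∂μ, letacMap y x ∈ avoid μ E := by
  refine ae_all_iff.2 fun n => ?_
  exact (letacKernel_pow_succ_apply_eq_zero n x hE).1 (hx (n + 1))

lemma avoid_subset_compl {E : Set ℝ} (hE : MeasurableSet E) : avoid μ E ⊆ Eᶜ := by
  intro x hx hxE
  have := hx 0
  rw [pow_zero_apply _ _ hE] at this
  simp [hxE] at this

lemma pow_compl_eq_zero_of_absorbing {S : Set ℝ} (hS : MeasurableSet S)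
    (h : ∀ x ∈ S, ∀ᵐ y ∂μ, letacMap y x ∈ S) (n : ℕ) {x : ℝ} (hx : x ∈ S) :
    (letacKernel μ ^ n) x Sᶜ = 0 := by
  induction n generalizing x with
  | zero => rw [pow_zero_apply _ _ hS.compl]; simp [hx]
  | succ n ih =>
    rw [letacKernel_pow_succ_apply_eq_zero _ _ hS.compl]
    filter_upwards [h x hx] with y hy using ih hy

end Basic

/-! ### Locally uniform access to `C` on a dense open set. -/

namespace Minorization

variable {μ : Measure (ℝ × ℝ × ℝ)} [IsProbabilityMeasure μ] (R : Minorization (letacKernel μ))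

lemma ofReal_δ_pos : 0 < ENNReal.ofReal R.δ := ENNReal.ofReal_pos.2 R.δ_pos

lemma exists_pow_apply_C_pos (x : ℝ) : ∃ n, 0 < (letacKernel μ ^ n) x R.C := by
  obtain ⟨φ, hφ, hC⟩ := R.charged_C
  exact hφ.irreducible R.measurableSet_C hC x

lemma exists_lintegral_pow_apply_C_pos {m : Measure ℝ} (hm : m ≠ 0) :
    ∃ n, 0 < ∫⁻ x, (letacKernel μ ^ n) x R.C ∂m := by
  by_contra! h
  apply hm
  have h' : ∀ᵐ x ∂m, ∀ n, (letacKernel μ ^ n) x R.C = 0 := ae_all_iff.2 fun n =>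
    (lintegral_eq_zero_iff (Kernel.measurable_coe _ R.measurableSet_C)).1 (le_antisymm (h n) zero_le)
  refine Measure.measure_univ_eq_zero.1 (measure_mono_null (fun x _ => ?_) (ae_iff.1 h'))
  obtain ⟨n, hn⟩ := R.exists_pow_apply_C_pos x
  exact fun h0 => hn.ne' (h0 n)

lemma pow_apply_C_mul_le (n : ℕ) (x : ℝ) {E : Set ℝ} (hE : MeasurableSet E) :
    (letacKernel μ ^ n) x R.C * (ENNReal.ofReal R.δ * R.ν E) ≤ (letacKernel μ ^ (n + 1)) x E := by
  rw [pow_add_apply _ _ _ _ hE, pow_one, mul_comm, ← setLIntegral_const]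
  refine (setLIntegral_mono' R.measurableSet_C fun y hy => R.minor y hy E hE).trans
    (setLIntegral_le_lintegral _ _)

/-- The mean number of visits to `C` before time `N`. -/
noncomputable def hitSum (N : ℕ) (x : ℝ) : ℝ≥0∞ := ∑ n ∈ Finset.range N, (letacKernel μ ^ n) x R.C

lemma hitSum_mono (x : ℝ) : Monotone fun N => R.hitSum N x := fun _ _ h =>
  Finset.sum_le_sum_of_subset (Finset.range_mono h)

/-- Unlike `hitSum`, a minorization by `ν` survives limits of starting points: a lower bound on a
closed set is an upper bound on its open complement, where the kernel powers are lower
semicontinuous. -/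
lemma minor_of_mem_closure {N : ℕ} {ε : ℝ≥0∞} {x : ℝ} (hx : x ∈ closure {y | ε ≤ R.hitSum N y})
    {E : Set ℝ} (hE : MeasurableSet E) :
    ε * (ENNReal.ofReal R.δ * R.ν E)
      ≤ ∑ n ∈ Finset.range N, (letacKernel μ ^ (n + 1)) x E := by
  have hν := R.prob_ν
  have closed : ∀ F : Set ℝ, IsClosed F → ε * (ENNReal.ofReal R.δ * R.ν F)
      ≤ ∑ n ∈ Finset.range N, (letacKernel μ ^ (n + 1)) x F := by
    intro F hF
    have tot : ∀ y, ∑ n ∈ Finset.range N, (letacKernel μ ^ (n + 1)) y Fᶜ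
        + ∑ n ∈ Finset.range N, (letacKernel μ ^ (n + 1)) y F = N := by
      intro y
      rw [← Finset.sum_add_distrib]
      simp_rw [add_comm _ ((letacKernel μ ^ (_ + 1)) y F), measure_add_measure_compl hF.measurableSet,
        measure_univ]
      simp
    have lsc : LowerSemicontinuous fun y =>
        ∑ n ∈ Finset.range N, (letacKernel μ ^ (n + 1)) y Fᶜ + ε * (ENNReal.ofReal R.δ * R.ν F) :=
      (lowerSemicontinuous_sum fun n _ =>
        lowerSemicontinuous_letacKernel_pow (n + 1) hF.isOpen_compl).add lowerSemicontinuous_const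
    have key : {y | ε ≤ R.hitSum N y} ⊆ (fun y => ∑ n ∈ Finset.range N,
        (letacKernel μ ^ (n + 1)) y Fᶜ + ε * (ENNReal.ofReal R.δ * R.ν F)) ⁻¹' Set.Iic (N : ℝ≥0∞) := by
      intro y hy
      simp only [Set.mem_preimage, Set.mem_Iic]
      rw [← tot y]
      gcongr
      calc _ ≤ R.hitSum N y * (ENNReal.ofReal R.δ * R.ν F) := by gcongr; exact hy
        _ ≤ _ := by
          rw [hitSum, Finset.sum_mul]
          exact Finset.sum_le_sum fun n _ => R.pow_apply_C_mul_le n y hF.measurableSet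
    have := closure_minimal key (lsc.isClosed_preimage _) hx
    simp only [Set.mem_preimage, Set.mem_Iic] at this
    rw [← tot x] at this
    refine (ENNReal.add_le_add_iff_left ?_).1 this
    exact ne_top_of_le_ne_top (ENNReal.natCast_ne_top N) (le_self_add.trans (tot x).le)
  -- Inner regularity of `ν` passes from closed sets to Borel sets.
  rw [hE.measure_eq_iSup_isClosed_of_ne_top (measure_ne_top _ _)]
  simp only [ENNReal.mul_iSup]
  refine iSup₂_le fun F hFE => iSup_le fun hF => (closed F hF).trans ?_
  gcongr

/-- Points of the closure still have a fraction of `ν` in their future law, and from `ν` the set `C`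
is reached in some fixed number `k` of further steps with positive probability. -/
lemma closure_hitSum_subset {N : ℕ} {ε : ℝ≥0∞} (hε : 0 < ε) :
    ∃ N' : ℕ, ∃ ε' : ℝ≥0∞, 0 < ε' ∧
      closure {y | ε ≤ R.hitSum N y} ⊆ {y | ε' ≤ R.hitSum N' y} := by
  have hν := R.prob_ν
  obtain ⟨k, hk⟩ := R.exists_lintegral_pow_apply_C_pos (IsProbabilityMeasure.ne_zero R.ν)
  refine ⟨N + 1 + k, ε * (ENNReal.ofReal R.δ * ∫⁻ x, (letacKernel μ ^ k) x R.C ∂(R.ν)),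
    ENNReal.mul_pos hε.ne' (ENNReal.mul_pos R.ofReal_δ_pos.ne' hk.ne').ne', fun x hx => ?_⟩
  have hle : (ε * ENNReal.ofReal R.δ) • R.ν
      ≤ ∑ n ∈ Finset.range N, (letacKernel μ ^ (n + 1)) x := by
    refine Measure.le_iff.2 fun E hE => ?_
    simpa [mul_assoc] using R.minor_of_mem_closure hx hE
  have h2 := lintegral_mono' hle (le_refl fun x => (letacKernel μ ^ k) x R.C)
  rw [lintegral_smul_measure, lintegral_finsetSum_measure, smul_eq_mul, mul_assoc] at h2
  refine h2.trans ?_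
  simp_rw [← pow_add_apply _ _ _ _ R.measurableSet_C]
  rw [hitSum, ← Finset.sum_range_add_sum_Ico _ (show 1 + k ≤ N + 1 + k by omega)]
  refine le_trans (le_of_eq ?_) le_add_self
  rw [Finset.sum_Ico_eq_sum_range, show N + 1 + k - (1 + k) = N by omega]
  refine Finset.sum_congr rfl fun n _ => ?_
  rw [show n + 1 + k = 1 + k + n by omega]

/-- The points with a neighbourhood from which `C` is reached with a uniform lower bound. -/
def goodSet : Set ℝ :=
  {x | ∃ N : ℕ, ∃ ε : ℝ≥0∞, 0 < ε ∧ ∀ᶠ y in 𝓝 x, ε ≤ R.hitSum N y}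

lemma isOpen_goodSet : IsOpen R.goodSet := by
  rw [isOpen_iff_mem_nhds]
  rintro x ⟨N, ε, hε, h⟩
  filter_upwards [eventually_eventually_nhds.2 h] with y hy
  exact ⟨N, ε, hε, hy⟩

lemma exists_inv_le_hitSum {N : ℕ} {ε : ℝ≥0∞} (hε : 0 < ε) (S : Set ℝ)
    (h : ∀ y ∈ S, ε ≤ R.hitSum N y) :
    ∃ k : ℕ, ∀ y ∈ S, ((k : ℝ≥0∞) + 1)⁻¹ ≤ R.hitSum k y := by
  obtain ⟨m, hm⟩ := ENNReal.exists_inv_nat_lt hε.ne'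
  refine ⟨max m N, fun y hy => le_trans ?_ ((h y hy).trans (R.hitSum_mono y (le_max_right m N)))⟩
  refine le_trans (ENNReal.inv_le_inv.2 ?_) hm.le
  exact_mod_cast (le_max_left m N).trans (Nat.le_succ _)

/-- Baire: irreducibility makes the closed sets in the union cover the line, so their interiors have
dense union, and `closure_hitSum_subset` removes the closures. -/
lemma dense_goodSet : Dense R.goodSet := by
  have hU : (⋃ k : ℕ, closure {y | ((k : ℝ≥0∞) + 1)⁻¹ ≤ R.hitSum k y}) = Set.univ := by
    refine Set.eq_univ_of_forall fun x => ?_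
    obtain ⟨n, hn⟩ := R.exists_pow_apply_C_pos x
    obtain ⟨k, hk⟩ := R.exists_inv_le_hitSum (N := n + 1) hn {x} fun y hy => by
      rw [Set.mem_singleton_iff.1 hy, hitSum]
      exact Finset.single_le_sum (f := fun n => (letacKernel μ ^ n) x R.C)
        (fun _ _ => zero_le) (Finset.self_mem_range_succ n)
    exact Set.mem_iUnion.2 ⟨k, subset_closure (hk x rfl)⟩
  refine (dense_iUnion_interior_of_closed (fun k => isClosed_closure) hU).mono ?_
  refine Set.iUnion_subset fun k x hx => ?_
  obtain ⟨N', ε', hε', hsub⟩ := R.closure_hitSum_subset (N := k) (ε := ((k : ℝ≥0∞) + 1)⁻¹)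
    (ENNReal.inv_pos.2 (by simp))
  exact ⟨N', ε', hε', mem_of_superset (mem_interior_iff_mem_nhds.1 hx) hsub⟩

lemma goodSet_eq_iUnion : R.goodSet
    = ⋃ k : ℕ, interior {y | ((k : ℝ≥0∞) + 1)⁻¹ ≤ R.hitSum k y} := by
  ext x
  refine ⟨?_, fun hx => ?_⟩
  · rintro ⟨N, ε, hε, h⟩
    obtain ⟨k, hk⟩ := R.exists_inv_le_hitSum hε _ (fun y (hy : y ∈ {y | ε ≤ R.hitSum N y}) => hy)
    exact Set.mem_iUnion.2 ⟨k, mem_interior_iff_mem_nhds.2 (mem_of_superset h hk)⟩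
  · obtain ⟨k, hk⟩ := Set.mem_iUnion.1 hx
    exact ⟨k, _, ENNReal.inv_pos.2 (by simp), mem_interior_iff_mem_nhds.1 hk⟩

lemma lintegral_hitSum_letacMap_le (N : ℕ) (x : ℝ) :
    ∫⁻ y, R.hitSum N (letacMap y x) ∂μ ≤ R.hitSum (N + 1) x := by
  simp only [hitSum]
  rw [lintegral_finsetSum _ fun n _ => by
      exact (Kernel.measurable_coe _ R.measurableSet_C).comp (measurable_letacMap_left x),
    Finset.sum_range_succ']
  simp_rw [← letacKernel_pow_succ_apply _ _ R.measurableSet_C]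
  exact le_self_add

/-- If a point could move into the good set, it would enter one of countably many open sets with a
uniform bound; by lower semicontinuity so would its neighbours, and the point would itself be good.
-/
lemma ae_letacMap_notMem_goodSet {x : ℝ} (hx : x ∉ R.goodSet) :
    ∀ᵐ y ∂μ, letacMap y x ∉ R.goodSet := by
  by_contra hcon
  apply hx
  have hpos : ∃ k : ℕ,
      0 < letacKernel μ x (interior {y | ((k : ℝ≥0∞) + 1)⁻¹ ≤ R.hitSum k y}) := by
    by_contra! h0
    apply hcon
    have h0' : ∀ᵐ y ∂μ, ∀ k : ℕ,
        letacMap y x ∉ interior {y | ((k : ℝ≥0∞) + 1)⁻¹ ≤ R.hitSum k y} := by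
      refine ae_all_iff.2 fun k => ?_
      have := le_antisymm (h0 k) zero_le
      rw [letacKernel_apply _ isOpen_interior.measurableSet] at this
      rw [ae_iff]
      simpa using this
    filter_upwards [h0'] with y hy
    rw [goodSet_eq_iUnion]
    simpa using hy
  obtain ⟨k, hk⟩ := hpos
  obtain ⟨c, hc0, hc⟩ := exists_between hk
  refine ⟨k + 1, c * ((k : ℝ≥0∞) + 1)⁻¹,
    ENNReal.mul_pos hc0.ne' (ENNReal.inv_ne_zero.2 (by simp)), ?_⟩
  have lsc := lowerSemicontinuous_letacKernel_pow (μ := μ) 1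
    (isOpen_interior (s := {y | ((k : ℝ≥0∞) + 1)⁻¹ ≤ R.hitSum k y}))
  simp only [pow_one] at lsc
  filter_upwards [lsc x c hc] with z hz
  refine le_trans ?_ (R.lintegral_hitSum_letacMap_le k z)
  have hm : MeasurableSet {y | letacMap y z ∈ interior {y | ((k : ℝ≥0∞) + 1)⁻¹ ≤ R.hitSum k y}} :=
    measurable_letacMap_left z isOpen_interior.measurableSet
  rw [letacKernel_apply _ isOpen_interior.measurableSet] at hz
  refine le_trans ?_ (setLIntegral_le_lintegral
    {y | letacMap y z ∈ interior {y | ((k : ℝ≥0∞) + 1)⁻¹ ≤ R.hitSum k y}} _)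
  refine le_trans ?_ (setLIntegral_mono' hm (f := fun _ => ((k : ℝ≥0∞) + 1)⁻¹) fun y hy => ?_)
  · rw [setLIntegral_const, mul_comm]
    gcongr
  · exact (interior_subset hy : letacMap y z ∈ {y | ((k : ℝ≥0∞) + 1)⁻¹ ≤ R.hitSum k y})

lemma exists_le_hitSum_of_isCompact {K : Set ℝ} (hK : IsCompact K) (h : K ⊆ R.goodSet) :
    ∃ N : ℕ, ∃ ε : ℝ≥0∞, 0 < ε ∧ ∀ y ∈ K, ε ≤ R.hitSum N y := by
  refine hK.induction_on (p := fun S => ∃ N : ℕ, ∃ ε : ℝ≥0∞, 0 < ε ∧ ∀ y ∈ S, ε ≤ R.hitSum N y)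
    ⟨0, 1, by simp⟩ ?_ ?_ ?_
  · rintro s t hst ⟨N, ε, hε, ht⟩
    exact ⟨N, ε, hε, fun y hy => ht y (hst hy)⟩
  · rintro s t ⟨N, ε, hε, hs⟩ ⟨N', ε', hε', ht⟩
    refine ⟨max N N', min ε ε', lt_min hε hε', ?_⟩
    rintro y (hy | hy)
    · exact (min_le_left _ _).trans ((hs y hy).trans (R.hitSum_mono y (le_max_left _ _)))
    · exact (min_le_right _ _).trans ((ht y hy).trans (R.hitSum_mono y (le_max_right _ _)))
  · intro x hx
    obtain ⟨N, ε, hε, hev⟩ := h hx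
    exact ⟨_, mem_nhdsWithin_of_mem_nhds hev, N, ε, hε, fun y hy => hy⟩

end Minorization

/-! ### Orbits under a semigroup of affine maps. -/

section AffineSemigroup

/-- The intercept depends on the word only, not on `q`; this makes its effect negligible for large
`q`. -/
lemma exists_forall_word_mem {S : Set ℝ} {a b a' b' : ℝ} (h : ∀ q ∈ S, a * q + b ∈ S)
    (h' : ∀ q ∈ S, a' * q + b' ∈ S) (i j : ℕ) : ∃ c, ∀ q ∈ S, a ^ i * a' ^ j * q + c ∈ S := by
  induction i with
  | zero =>
    induction j with
    | zero => exact ⟨0, fun q hq => by simpa using hq⟩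
    | succ j ih =>
      obtain ⟨c, hc⟩ := ih
      refine ⟨a' * c + b', fun q hq => ?_⟩
      convert h' _ (hc q hq) using 1
      ring
  | succ i ih =>
    obtain ⟨c, hc⟩ := ih
    refine ⟨a * c + b, fun q hq => ?_⟩
    convert h _ (hc q hq) using 1
    ring

lemma iterate_contraction_mem {S : Set ℝ} {a b r : ℝ} (h : ∀ q ∈ S, a * q + b ∈ S)
    (hr : a * r + b = r) (n : ℕ) {q : ℝ} (hq : q ∈ S) : r + a ^ n * (q - r) ∈ S := by
  induction n with
  | zero => simpa using hq
  | succ n ih =>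
    convert h _ ih using 1
    linear_combination -hr

/-- A set that is unbounded above and invariant under a contraction with fixed point `r` and under
two affine maps with slopes of ratio less than `σ₂ / σ₁` meets each slight enlargement of
`(r + σ₁, r + σ₂)`. -/
lemma exists_mem_of_affine_invariant {S : Set ℝ} (hS : ∀ H, ∃ q ∈ S, H < q)
    {a₀ b₀ a b a' b' r σ₁ σ₂ η : ℝ} (h₀ : ∀ q ∈ S, a₀ * q + b₀ ∈ S) (h : ∀ q ∈ S, a * q + b ∈ S)
    (h' : ∀ q ∈ S, a' * q + b' ∈ S) (ha₀ : 0 < a₀) (ha₀' : a₀ < 1) (hr : a₀ * r + b₀ = r)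
    (ha : 0 < a) (haa' : a < a') (hσ₁ : 0 < σ₁) (hσ : a' * σ₁ ≤ a * σ₂) (hη : 0 < η) :
    ∃ p ∈ S, r + σ₁ - η < p ∧ p < r + σ₂ + η := by
  have ha' : 0 < a' := ha.trans haa'
  -- Exchanging `k` factors `a` for `a'` outweighs one factor `a₀`, so the slopes `a₀^m a^(k-j)
  -- a'^j` leave no multiplicative gap larger than `a'/a`.
  obtain ⟨k, hk⟩ : ∃ k : ℕ, a ^ k ≤ a₀ * a' ^ k := by
    obtain ⟨k, hk⟩ := exists_pow_lt_of_lt_one ha₀ ((div_lt_one ha').2 haa')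
    refine ⟨k, ?_⟩
    rw [div_pow, div_lt_iff₀ (by positivity)] at hk
    exact hk.le
  choose c hc using fun j : ℕ => exists_forall_word_mem h h' (k - j) j
  obtain ⟨K, hK⟩ : ∃ K, ∀ j ≤ k, |c j - r| ≤ K :=
    ⟨∑ j ∈ Finset.range (k + 1), |c j - r|, fun j hj =>
      Finset.single_le_sum (f := fun j => |c j - r|) (fun _ _ => abs_nonneg _)
        (Finset.mem_range.2 (Nat.lt_succ_of_le hj))⟩
  have hK0 : 0 ≤ K := (abs_nonneg _).trans (hK 0 (Nat.zero_le _))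
  -- The first summand makes the orbit start above `σ₁`; the second makes the intercepts, once
  -- contracted to scale `σ₁`, smaller than `η`.
  obtain ⟨q, hq, hqH⟩ := hS (σ₁ / a ^ k + σ₁ * K / (η * a ^ k))
  have hak : 0 < a ^ k := by positivity
  have hq1 : σ₁ < a ^ k * q := by
    have h1 : σ₁ / a ^ k < q := lt_of_le_of_lt (le_add_of_nonneg_right (by positivity)) hqH
    rw [div_lt_iff₀ hak] at h1
    linarith
  have hq2 : σ₁ * K < η * (a ^ k * q) := by
    have h1 : σ₁ * K / (η * a ^ k) < q := lt_of_le_of_lt (le_add_of_nonneg_left (by positivity)) hqH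
    rw [div_lt_iff₀ (by positivity)] at h1
    linarith
  have hex : ∃ n : ℕ, a₀ ^ n * (a ^ k * q) ≤ σ₁ := by
    obtain ⟨n, hn⟩ := exists_pow_lt_of_lt_one (div_pos hσ₁ (hσ₁.trans hq1)) ha₀'
    exact ⟨n, ((lt_div_iff₀ (hσ₁.trans hq1)).1 hn).le⟩
  classical
  obtain ⟨n, hn, hn'⟩ : ∃ n : ℕ, a₀ ^ (n + 1) * (a ^ k * q) ≤ σ₁ ∧ σ₁ < a₀ ^ n * (a ^ k * q) := by
    have h0 : Nat.find hex ≠ 0 := by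
      intro h0
      have := Nat.find_spec hex
      rw [h0] at this
      linarith
    obtain ⟨n, hn⟩ := Nat.exists_eq_succ_of_ne_zero h0
    refine ⟨n, ?_, ?_⟩
    · have := Nat.find_spec hex
      rwa [hn] at this
    · exact not_le.1 (Nat.find_min hex (by omega))
  have hex' : ∃ j : ℕ, σ₁ < a₀ ^ (n + 1) * (a ^ (k - j) * a' ^ j * q) := by
    refine ⟨k, hn'.trans_le ?_⟩
    have hq0 : 0 < q := by
      by_contra hcon
      nlinarith [mul_nonneg hak.le (neg_nonneg.2 (not_lt.1 hcon))]
    calc a₀ ^ n * (a ^ k * q) ≤ a₀ ^ n * (a₀ * a' ^ k * q) := by gcongr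
      _ = _ := by simp; ring
  -- The first exchange that lifts the product above `σ₁` overshoots by a factor at most `a'/a`,
  -- hence stays below `σ₂`.
  obtain ⟨j, hjk, hj, hj'⟩ : ∃ j, j + 1 ≤ k ∧
      a₀ ^ (n + 1) * (a ^ (k - j) * a' ^ j * q) ≤ σ₁ ∧
      σ₁ < a₀ ^ (n + 1) * (a ^ (k - (j + 1)) * a' ^ (j + 1) * q) := by
    have h0 : Nat.find hex' ≠ 0 := by
      intro h0
      have := Nat.find_spec hex'
      rw [h0] at this
      simp at this
      linarith
    obtain ⟨j, hj⟩ := Nat.exists_eq_succ_of_ne_zero h0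
    have hle : Nat.find hex' ≤ k := by
      refine Nat.find_min' hex' ?_
      have hq0 : 0 < q := by
        by_contra hcon
        nlinarith [mul_nonneg hak.le (neg_nonneg.2 (not_lt.1 hcon))]
      refine hn'.trans_le ?_
      calc a₀ ^ n * (a ^ k * q) ≤ a₀ ^ n * (a₀ * a' ^ k * q) := by gcongr
        _ = _ := by simp; ring
    refine ⟨j, by omega, not_lt.1 (Nat.find_min hex' (by omega)), ?_⟩
    have := Nat.find_spec hex'
    rwa [hj] at this
  refine ⟨_, iterate_contraction_mem h₀ hr (n + 1) (hc (j + 1) q hq), ?_⟩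
  have hup : a₀ ^ (n + 1) * (a ^ (k - (j + 1)) * a' ^ (j + 1) * q) ≤ σ₂ := by
    have e : k - j = k - (j + 1) + 1 := by omega
    rw [e] at hj
    have : a * (a₀ ^ (n + 1) * (a ^ (k - (j + 1)) * a' ^ (j + 1) * q))
        = a' * (a₀ ^ (n + 1) * (a ^ (k - (j + 1) + 1) * a' ^ j * q)) := by ring
    nlinarith [mul_le_mul_of_nonneg_left hj ha'.le]
  have herr : |a₀ ^ (n + 1) * (c (j + 1) - r)| < η := by
    rw [abs_mul, abs_of_pos (by positivity)]
    have h1 : a₀ ^ (n + 1) * |c (j + 1) - r| ≤ a₀ ^ (n + 1) * K := by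
      gcongr
      exact hK _ hjk
    refine h1.trans_lt ?_
    have hpos := hσ₁.trans hq1
    have h2 : a₀ ^ (n + 1) * K * (a ^ k * q) < η * (a ^ k * q) :=
      lt_of_le_of_lt (by nlinarith [mul_le_mul_of_nonneg_right hn hK0]) hq2
    exact lt_of_mul_lt_mul_right h2 hpos.le
  rw [abs_lt] at herr
  constructor <;> nlinarith [herr.1, herr.2]

end AffineSemigroup

/-! ### Slopes in the support of `(A, B)`. -/

section Support

variable {μ : Measure (ℝ × ℝ × ℝ)}

/-- The closed support of the law of `(A, B)`. -/
def slopeSupport (μ : Measure (ℝ × ℝ × ℝ)) : Set (ℝ × ℝ) :=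
  (μ.map fun y => (y.1, y.2.1)).support

lemma ae_mem_slopeSupport : ∀ᵐ y ∂μ, (y.1, y.2.1) ∈ slopeSupport μ :=
  ae_of_ae_map (by fun_prop) Measure.support_mem_ae

lemma mem_of_mem_slopeSupport {S : Set ℝ} (hS : IsClosed S) {q : ℝ}
    (h : ∀ᵐ y ∂μ, y.1 * q + y.2.1 ∈ S) {p : ℝ × ℝ} (hp : p ∈ slopeSupport μ) :
    p.1 * q + p.2 ∈ S := by
  have hcl : IsClosed {p : ℝ × ℝ | p.1 * q + p.2 ∈ S} := hS.preimage (by fun_prop)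
  refine Measure.support_subset_of_isClosed hcl ?_ hp
  exact (ae_map_iff (by fun_prop) hcl.measurableSet).2 h

/-- Otherwise distinct positive slopes in the support differ by a factor at least `c`, so the
integer part of their logarithm to base `c` is injective, and `A` would live on a countable set. -/
lemma exists_slopes_lt_mul (hA : ∀ᵐ y ∂μ, 0 < y.1)
    (hA' : ∀ S : Set ℝ, S.Countable → ¬ ∀ᵐ y ∂μ, y.1 ∈ S) {c : ℝ} (hc : 1 < c) :
    ∃ p ∈ slopeSupport μ, ∃ p' ∈ slopeSupport μ, 0 < p.1 ∧ p.1 < p'.1 ∧ p'.1 < c * p.1 := by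
  by_contra! hcon
  refine hA' {a | 0 < a ∧ ∃ b, (a, b) ∈ slopeSupport μ} ?_ ?_
  · refine Set.MapsTo.countable_of_injOn (f := fun a => ⌊Real.log a / Real.log c⌋)
      (t := Set.univ) (fun _ _ => Set.mem_univ _) ?_ (Set.to_countable _)
    have key : ∀ a a' b b', 0 < a → (a, b) ∈ slopeSupport μ → (a', b') ∈ slopeSupport μ → a < a' →
        ⌊Real.log a / Real.log c⌋ ≠ ⌊Real.log a' / Real.log c⌋ := by
      intro a a' b b' ha hb hb' hlt heq
      have h1 := hcon _ hb _ hb' ha hlt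
      have hlc := Real.log_pos hc
      have h2 := Real.log_le_log (by positivity) h1
      simp only at h2
      rw [Real.log_mul (by positivity) (by positivity)] at h2
      have h3 : Real.log a / Real.log c + 1 ≤ Real.log a' / Real.log c := by
        rw [div_add_one hlc.ne', div_le_div_iff_of_pos_right hlc]
        linarith
      have h4 := Int.floor_le (Real.log a' / Real.log c)
      have h5 := Int.lt_floor_add_one (Real.log a / Real.log c)
      have h6 := Int.floor_mono h3
      rw [Int.floor_add_one] at h6
      omega
    rintro a ⟨ha, b, hb⟩ a' ⟨ha', b', hb'⟩ heq
    rcases lt_trichotomy a a' with hlt | rfl | hlt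
    · exact absurd heq (key a a' b b' ha hb hb' hlt)
    · rfl
    · exact absurd heq.symm (key a' a b' b ha' hb' hb hlt)
  · filter_upwards [hA, ae_mem_slopeSupport] with y h1 h2 using ⟨h1, _, h2⟩

end Support

/-! ### Points above `D`, where the random map is affine. -/

section Dominance

variable {μ : Measure (ℝ × ℝ × ℝ)}

/-- The points that are almost surely at least `D`. -/
def aboveD (μ : Measure (ℝ × ℝ × ℝ)) : Set ℝ := {x | ∀ᵐ y ∂μ, y.2.2 ≤ x}

lemma isClosed_aboveD : IsClosed (aboveD μ) := by
  refine IsSeqClosed.isClosed fun s x hs hx => ?_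
  have h : ∀ᵐ y ∂μ, ∀ n, y.2.2 ≤ s n := ae_all_iff.2 hs
  filter_upwards [h] with y hy
  exact ge_of_tendsto' hx hy

lemma isUpperSet_aboveD : IsUpperSet (aboveD μ) := by
  intro a b hab ha
  change ∀ᵐ y ∂μ, y.2.2 ≤ b
  filter_upwards [(ha : ∀ᵐ y ∂μ, y.2.2 ≤ a)] with y hy using hy.trans hab

lemma bddBelow_aboveD [IsProbabilityMeasure μ] : BddBelow (aboveD μ) := by
  by_contra hcon
  rw [not_bddBelow_iff] at hcon
  have h : ∀ᵐ y ∂μ, ∀ n : ℕ, y.2.2 ≤ -(n : ℝ) := ae_all_iff.2 fun n => by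
    obtain ⟨x, hx, hxn⟩ := hcon (-(n : ℝ))
    filter_upwards [(hx : ∀ᵐ y ∂μ, y.2.2 ≤ x)] with y hy using hy.trans hxn.le
  obtain ⟨y, hy⟩ := h.exists
  obtain ⟨n, hn⟩ := exists_nat_gt (-y.2.2)
  linarith [hy n]

lemma ae_letacMap_eq {x : ℝ} (hx : x ∈ aboveD μ) :
    ∀ᵐ y ∂μ, letacMap y x = y.1 * x + y.2.1 := by
  filter_upwards [(hx : ∀ᵐ y ∂μ, y.2.2 ≤ x)] with y hy
  rw [letacMap, max_eq_right hy]

lemma measure_lt_pos_of_notMem_aboveD {x : ℝ} (hx : x ∉ aboveD μ) : 0 < μ {y | x < y.2.2} := by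
  refine pos_iff_ne_zero.2 fun h0 => hx ?_
  rw [aboveD, Set.mem_ofPred_eq, ae_iff]
  simpa using h0

end Dominance

/-! ### Uniform access to `C` from bounded sets. -/

namespace Minorization

variable {μ : Measure (ℝ × ℝ × ℝ)} [IsProbabilityMeasure μ] (R : Minorization (letacKernel μ))

/-- From a point of `S` the chain reaches `C`, and from there a fraction `δ` of the next law is `ν`;
as `S` cannot be left, it carries `ν`. In particular two nonempty absorbing sets are never disjoint.
-/
lemma ν_compl_eq_zero_of_absorbing {S : Set ℝ} (hS : MeasurableSet S) (hne : S.Nonempty)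
    (h : ∀ x ∈ S, ∀ᵐ y ∂μ, letacMap y x ∈ S) : R.ν Sᶜ = 0 := by
  obtain ⟨x, hx⟩ := hne
  obtain ⟨n, hn⟩ := R.exists_pow_apply_C_pos x
  have h1 := R.pow_apply_C_mul_le n x hS.compl
  rw [pow_compl_eq_zero_of_absorbing hS h _ hx, nonpos_iff_eq_zero, mul_eq_zero, mul_eq_zero] at h1
  rcases h1 with h1 | h1 | h1
  · exact absurd h1 hn.ne'
  · exact absurd h1 R.ofReal_δ_pos.ne'
  · exact h1

/-- If the chain started at `M` can fall below `D`, then it forgets starting points below `M`. -/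
lemma exists_le_hitSum_of_pos_compl_aboveD (hA : ∀ᵐ y ∂μ, 0 < y.1) {M : ℝ} {n : ℕ}
    (h : 0 < (letacKernel μ ^ n) M (aboveD μ)ᶜ) :
    ∃ N : ℕ, ∃ ε : ℝ≥0∞, 0 < ε ∧ ∀ x ≤ M, ε ≤ R.hitSum N x := by
  -- On `D > z` the next value is `A D + B`, free of `z`. Only the event depends on `z`, and it
  -- shrinks as `z` grows, so `g k` is antitone.
  let g : ℕ → ℝ → ℝ≥0∞ := fun k z =>
    ∫⁻ y, {y : ℝ × ℝ × ℝ | z < y.2.2}.indicator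
      (fun y => (letacKernel μ ^ k) (y.1 * y.2.2 + y.2.1) R.C) y ∂μ
  have hmf : ∀ k, Measurable fun y : ℝ × ℝ × ℝ =>
      (letacKernel μ ^ k) (y.1 * y.2.2 + y.2.1) R.C := fun k =>
    (Kernel.measurable_coe _ R.measurableSet_C).comp (by fun_prop)
  have hms : ∀ z : ℝ, MeasurableSet {y : ℝ × ℝ × ℝ | z < y.2.2} := fun z =>
    measurableSet_lt measurable_const (by fun_prop)
  have hg : ∀ k, Measurable (g k) := by
    intro k
    have hm : Measurable fun p : ℝ × (ℝ × ℝ × ℝ) =>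
        {p : ℝ × (ℝ × ℝ × ℝ) | p.1 < p.2.2.2}.indicator
          (fun p => (letacKernel μ ^ k) (p.2.1 * p.2.2.2 + p.2.2.1) R.C) p :=
      ((hmf k).comp measurable_snd).indicator (measurableSet_lt (by fun_prop) (by fun_prop))
    exact hm.lintegral_prod_right'
  have hganti : ∀ k, Antitone (g k) := fun k a b hab =>
    lintegral_mono fun y => Set.indicator_le_indicator_of_subset
      (Set.ofPred_subset_ofPred.2 fun y (hy : b < y.2.2) => lt_of_le_of_lt hab hy)
      (fun _ => zero_le) y
  have hgle : ∀ k z, g k z ≤ (letacKernel μ ^ (k + 1)) z R.C := by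
    intro k z
    rw [letacKernel_pow_succ_apply _ _ R.measurableSet_C]
    refine lintegral_mono fun y => ?_
    by_cases hy : z < y.2.2
    · simp [hy, letacMap, max_eq_left hy.le]
    · simp [hy]
  obtain ⟨k, hk⟩ : ∃ k, 0 < ∫⁻ z, g k z ∂((letacKernel μ ^ n) M) := by
    by_contra! h0
    have h1 : ∀ᵐ z ∂((letacKernel μ ^ n) M), ∀ k, g k z = 0 := ae_all_iff.2 fun k =>
      (lintegral_eq_zero_iff (hg k)).1 (le_antisymm (h0 k) zero_le)
    obtain ⟨z, hz, hzk⟩ : ∃ z ∈ (aboveD μ)ᶜ, ∀ k, g k z = 0 := by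
      by_contra! hcon
      refine h.ne' (measure_mono_null (fun z hz => ?_) (ae_iff.1 h1))
      obtain ⟨k, hk⟩ := hcon z hz
      exact fun h' => hk (h' k)
    have h2 : ∀ᵐ y ∂μ, ∀ k, {y : ℝ × ℝ × ℝ | z < y.2.2}.indicator
        (fun y => (letacKernel μ ^ k) (y.1 * y.2.2 + y.2.1) R.C) y = 0 := ae_all_iff.2 fun k =>
      (lintegral_eq_zero_iff ((hmf k).indicator (hms z))).1 (hzk k)
    refine (measure_lt_pos_of_notMem_aboveD hz).ne' (measure_mono_null ?_ (ae_iff.1 h2))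
    intro y hy h'
    obtain ⟨k, hk⟩ := R.exists_pow_apply_C_pos (y.1 * y.2.2 + y.2.1)
    have := h' k
    rw [Set.indicator_of_mem hy] at this
    exact hk.ne' this
  refine ⟨n + (k + 1) + 1, _, hk, fun x hx => ?_⟩
  calc ∫⁻ z, g k z ∂((letacKernel μ ^ n) M)
      ≤ ∫⁻ z, g k z ∂((letacKernel μ ^ n) x) :=
        antitone_lintegral_letacKernel_pow hA n (hg k) (hganti k) hx
    _ ≤ ∫⁻ z, (letacKernel μ ^ (k + 1)) z R.C ∂((letacKernel μ ^ n) x) := lintegral_mono (hgle k)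
    _ = (letacKernel μ ^ (n + (k + 1))) x R.C := (pow_add_apply _ _ _ _ R.measurableSet_C).symm
    _ ≤ _ := Finset.single_le_sum (f := fun n => (letacKernel μ ^ n) x R.C)
        (fun _ _ => zero_le) (Finset.self_mem_range_succ _)

section AffineRegime

lemma isClosed_avoid_compl_aboveD : IsClosed (avoid μ (aboveD μ)ᶜ) :=
  isClosed_avoid isClosed_aboveD.isOpen_compl

lemma avoid_compl_aboveD_subset : avoid μ (aboveD μ)ᶜ ⊆ aboveD μ := by
  simpa using avoid_subset_compl (μ := μ) isClosed_aboveD.isOpen_compl.measurableSet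

lemma isUpperSet_avoid_compl_aboveD (hA : ∀ᵐ y ∂μ, 0 < y.1) :
    IsUpperSet (avoid μ (aboveD μ)ᶜ) := fun _ _ hab ha n =>
  le_antisymm ((antitone_letacKernel_pow_apply hA n isClosed_aboveD.isOpen_compl.measurableSet
    isUpperSet_aboveD.compl hab).trans (ha n).le) zero_le

/-- If the chain from `x` stayed below `H`, the part of the affine region from which it does so
would be compact, nonempty and absorbing. A slope above `1` expands it unless it is one point `q`;
but then `q` is a common fixed point, and the affine region strictly above `q` is absorbing too, so
`ν` would charge two disjoint sets fully. -/
lemma exists_pow_Ioi_pos (R : Minorization (letacKernel μ)) {M : ℝ}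
    (hM : M ∈ avoid μ (aboveD μ)ᶜ) (hA : ∀ᵐ y ∂μ, 0 < y.1) (hgt : 0 < μ {y | 1 < y.1}) (x H : ℝ) :
    ∃ n, 0 < (letacKernel μ ^ n) x (Set.Ioi H) := by
  by_contra! hcon
  have hν := R.prob_ν
  set T := avoid μ (aboveD μ)ᶜ with hT
  set B := avoid μ (Set.Ioi H) with hB
  have hTcl : IsClosed T := isClosed_avoid_compl_aboveD
  have hBcl : IsClosed B := isClosed_avoid isOpen_Ioi
  have hTabs : ∀ z ∈ T, ∀ᵐ y ∂μ, letacMap y z ∈ T := fun z hz =>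
    ae_letacMap_mem_avoid isClosed_aboveD.isOpen_compl.measurableSet hz
  have hBabs : ∀ z ∈ B, ∀ᵐ y ∂μ, letacMap y z ∈ B := fun z hz =>
    ae_letacMap_mem_avoid measurableSet_Ioi hz
  have hTν : R.ν Tᶜ = 0 := R.ν_compl_eq_zero_of_absorbing hTcl.measurableSet ⟨M, hM⟩ hTabs
  have hBν : R.ν Bᶜ = 0 := R.ν_compl_eq_zero_of_absorbing hBcl.measurableSet
    ⟨x, fun n => le_antisymm (hcon n) zero_le⟩ hBabs
  have hLν : R.ν (T ∩ B)ᶜ = 0 := by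
    rw [Set.compl_inter]; exact measure_union_null hTν hBν
  have hLne : (T ∩ B).Nonempty := by
    by_contra hemp
    rw [Set.not_nonempty_iff_eq_empty.1 hemp, Set.compl_empty, measure_univ] at hLν
    exact one_ne_zero hLν
  have hLcpt : IsCompact (T ∩ B) := by
    obtain ⟨l, hl⟩ := bddBelow_aboveD (μ := μ)
    refine (isCompact_Icc (a := l) (b := H)).of_isClosed_subset (hTcl.inter hBcl) fun z hz => ?_
    exact ⟨hl (avoid_compl_aboveD_subset hz.1),
      not_lt.1 (avoid_subset_compl (μ := μ) measurableSet_Ioi hz.2)⟩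
  obtain ⟨q₁, hq₁, hmin⟩ := hLcpt.exists_isLeast hLne
  obtain ⟨q, hq, hmax⟩ := hLcpt.exists_isGreatest hLne
  have hLabs : ∀ z ∈ T ∩ B, ∀ᵐ y ∂μ, y.1 * z + y.2.1 ∈ T ∩ B := fun z hz => by
    filter_upwards [hTabs z hz.1, hBabs z hz.2, ae_letacMap_eq (avoid_compl_aboveD_subset hz.1)]
      with y h1 h2 h3
    rw [← h3]; exact ⟨h1, h2⟩
  -- A map of slope above `1` would stretch the distance between the extreme points `q₁` and `q`.
  have hqq : q ≤ q₁ := by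
    by_contra! hlt
    refine hgt.ne' (measure_mono_null ?_ (ae_iff.1 ((hLabs q₁ hq₁).and (hLabs q hq))))
    rintro y hy ⟨h1, h2⟩
    have := hmin h1
    have := hmax h2
    have : (1 : ℝ) < y.1 := hy
    nlinarith
  have hL : T ∩ B = {q} := by
    refine Set.Subset.antisymm (fun z hz => ?_) (Set.singleton_subset_iff.2 hq)
    exact le_antisymm (hmax hz) (hqq.trans (hmin hz))
  rw [hL] at hLν hLabs
  have hfix : ∀ᵐ y ∂μ, y.1 * q + y.2.1 = q := hLabs q rfl
  have hS : MeasurableSet (T ∩ Set.Ioi q) := hTcl.measurableSet.inter measurableSet_Ioi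
  have hSabs : ∀ z ∈ T ∩ Set.Ioi q, ∀ᵐ y ∂μ, letacMap y z ∈ T ∩ Set.Ioi q := by
    rintro z ⟨hz, hzq : q < z⟩
    filter_upwards [hTabs z hz, hfix, ae_letacMap_eq (avoid_compl_aboveD_subset hz), hA]
      with y h1 h2 h3 h4
    refine ⟨h1, ?_⟩
    rw [Set.mem_Ioi, h3]
    nlinarith
  have h0 := R.ν_compl_eq_zero_of_absorbing hS
    ⟨q + 1, isUpperSet_avoid_compl_aboveD hA (by linarith) hq.1, by simp⟩ hSabs
  have h1 : R.ν Set.univ = 0 :=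
    measure_mono_null (t := (T ∩ Set.Ioi q)ᶜ ∪ {q}ᶜ) (fun z _ => by
      by_cases hz : z = q
      · left; rw [hz]; simp
      · right; exact hz) (measure_union_null h0 hLν)
  rw [measure_univ] at h1
  exact one_ne_zero h1

lemma goodSet_eq_univ {M : ℝ} (hM : M ∈ avoid μ (aboveD μ)ᶜ) (hA : ∀ᵐ y ∂μ, 0 < y.1) (hgt : 0 < μ {y | 1 < y.1})
    (hlt : 0 < μ {y | y.1 < 1})
    (hA' : ∀ S : Set ℝ, S.Countable → ¬ ∀ᵐ y ∂μ, y.1 ∈ S) : R.goodSet = Set.univ := by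
  by_contra hne
  obtain ⟨x₀, hx₀⟩ := (Set.ne_univ_iff_exists_notMem _).1 hne
  set T := avoid μ (aboveD μ)ᶜ with hT
  have hTcl : IsClosed T := isClosed_avoid_compl_aboveD
  have hScl : IsClosed (R.goodSetᶜ ∩ T) := R.isOpen_goodSet.isClosed_compl.inter hTcl
  have hS : ∀ H, ∃ q ∈ R.goodSetᶜ ∩ T, H < q := by
    intro H
    obtain ⟨n, hn⟩ := R.exists_pow_Ioi_pos hM hA hgt x₀ (max H M)
    have h0 : (letacKernel μ ^ n) x₀ R.goodSetᶜᶜ = 0 :=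
      pow_compl_eq_zero_of_absorbing R.isOpen_goodSet.measurableSet.compl
        (fun x hx => R.ae_letacMap_notMem_goodSet hx) n hx₀
    obtain ⟨q, hq, hq'⟩ : ∃ q ∈ Set.Ioi (max H M), q ∈ R.goodSetᶜ := by
      by_contra! hcon
      exact hn.ne' (measure_mono_null hcon h0)
    exact ⟨q, ⟨hq', isUpperSet_avoid_compl_aboveD hA ((le_max_right H M).trans (le_of_lt hq)) hM⟩,
      (le_max_left H M).trans_lt hq⟩
  have hinv : ∀ p ∈ slopeSupport μ, ∀ q ∈ R.goodSetᶜ ∩ T, p.1 * q + p.2 ∈ R.goodSetᶜ ∩ T := by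
    intro p hp q hq
    refine mem_of_mem_slopeSupport hScl ?_ hp
    filter_upwards [R.ae_letacMap_notMem_goodSet hq.1,
      ae_letacMap_mem_avoid isClosed_aboveD.isOpen_compl.measurableSet hq.2,
      ae_letacMap_eq (avoid_compl_aboveD_subset hq.2)] with y h1 h2 h3
    rw [← h3]; exact ⟨h1, h2⟩
  obtain ⟨p₀, hp₀, hp₀pos, hp₀lt⟩ : ∃ p ∈ slopeSupport μ, 0 < p.1 ∧ p.1 < 1 := by
    by_contra! hcon
    refine hlt.ne' (measure_mono_null ?_ (ae_iff.1 (hA.and (ae_mem_slopeSupport (μ := μ)))))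
    rintro y hy ⟨h1, h2⟩
    exact absurd hy (not_lt.2 (hcon _ h2 h1))
  obtain ⟨r, hr⟩ : ∃ r, p₀.1 * r + p₀.2 = r := by
    refine ⟨p₀.2 / (1 - p₀.1), ?_⟩
    have : 1 - p₀.1 ≠ 0 := by linarith
    field_simp
    ring
  obtain ⟨z, hzr, hz⟩ := R.dense_goodSet.inter_open_nonempty _ (isOpen_Ioi (a := r)) ⟨r + 1, by simp⟩
  obtain ⟨e, he, hball⟩ := Metric.isOpen_iff.1 R.isOpen_goodSet z hz
  have hzr' : r < z := hzr
  set σ₁ := z - r with hσ₁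
  have hσ₁pos : 0 < σ₁ := by linarith
  obtain ⟨p, hp, p', hp', hpos, hpp', hlt'⟩ :=
    exists_slopes_lt_mul hA hA' (c := (σ₁ + e / 4) / σ₁) (by rw [lt_div_iff₀ hσ₁pos]; linarith)
  obtain ⟨w, hw, hw1, hw2⟩ := exists_mem_of_affine_invariant hS (hinv _ hp₀) (hinv _ hp) (hinv _ hp')
    hp₀pos hp₀lt hr hpos hpp' hσ₁pos (σ₂ := σ₁ + e / 4) (η := e / 4) (by
      rw [div_mul_eq_mul_div, lt_div_iff₀ hσ₁pos] at hlt'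
      linarith) (by linarith)
  refine hw.1 (hball ?_)
  rw [Metric.mem_ball, Real.dist_eq, abs_lt]
  constructor <;> linarith

end AffineRegime

/-- Uniformly over starting points in a bounded set, `C` is reached. -/
lemma exists_le_hitSum (hA : ∀ᵐ y ∂μ, 0 < y.1) (hgt : 0 < μ {y | 1 < y.1})
    (hlt : 0 < μ {y | y.1 < 1}) (hA' : ∀ S : Set ℝ, S.Countable → ¬ ∀ᵐ y ∂μ, y.1 ∈ S) (M : ℝ) :
    ∃ N : ℕ, ∃ ε : ℝ≥0∞, 0 < ε ∧ ∀ x, |x| ≤ M → ε ≤ R.hitSum N x := by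
  by_cases hM : M ∈ avoid μ (aboveD μ)ᶜ
  · obtain ⟨N, ε, hε, h⟩ := R.exists_le_hitSum_of_isCompact (isCompact_Icc (a := -M) (b := M))
      (by rw [R.goodSet_eq_univ hM hA hgt hlt hA']; exact Set.subset_univ _)
    exact ⟨N, ε, hε, fun x hx => h x (abs_le.1 hx)⟩
  · simp only [avoid, Set.mem_ofPred_eq, not_forall] at hM
    obtain ⟨n, hn⟩ := hM
    obtain ⟨N, ε, hε, h⟩ := R.exists_le_hitSum_of_pos_compl_aboveD hA (pos_iff_ne_zero.2 hn)
    exact ⟨N, ε, hε, fun x hx => h x (abs_le.1 hx).2⟩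

end Minorization

namespace Minorization

section Killed

variable {P : Kernel ℝ ℝ} (R : Minorization P)

/-- The sub-Markov kernel `P - δ 1_C ⊗ ν` of the chain killed at regeneration. -/
noncomputable def killed : Kernel ℝ ℝ := by
  classical
  exact Kernel.piecewise R.measurableSet_C
    ⟨fun x => ENNReal.ofReal (1 - R.δ) • R.splitLaw (x, false), by
      refine Measure.measurable_of_measurable_coe _ fun s hs => ?_
      simp only [Measure.smul_apply, smul_eq_mul]
      exact ((Measure.measurable_coe hs).comp
        (R.measurable_splitLaw.comp measurable_prodMk_right)).const_mul _⟩ P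

lemma killed_of_mem {x : ℝ} (hx : x ∈ R.C) :
    R.killed x = ENNReal.ofReal (1 - R.δ) • R.splitLaw (x, false) := by
  simp [killed, Kernel.piecewise_apply, hx]

lemma killed_of_notMem {x : ℝ} (hx : x ∉ R.C) : R.killed x = P x := by
  simp [killed, Kernel.piecewise_apply, hx]

/-- The part of the `n`-th moment of the killed chain that stems from the additive terms. -/
noncomputable def inputSum (β b : ℝ≥0∞) (x : ℝ) : ℕ → ℝ≥0∞
  | 0 => 0
  | n + 1 => β * inputSum β b x n + b * (R.killed ^ n) x Set.univ

lemma tsum_inputSum_le {β b : ℝ≥0∞} (hβ : β < 1) (x : ℝ) :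
    ∑' n, R.inputSum β b x n ≤ b * (1 - β)⁻¹ * ∑' n, (R.killed ^ n) x Set.univ := by
  have h0 : 1 - β ≠ 0 := (tsub_pos_of_lt hβ).ne'
  have h1 : 1 - β ≠ ⊤ := ne_top_of_le_ne_top ENNReal.one_ne_top tsub_le_self
  have key : ∀ m, ∑ n ∈ Finset.range m, R.inputSum β b x n
      ≤ b * (1 - β)⁻¹ * ∑ n ∈ Finset.range m, (R.killed ^ n) x Set.univ := by
    intro m
    induction m with
    | zero => simp
    | succ m ih =>
      rw [Finset.sum_range_succ']
      simp only [inputSum, add_zero]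
      rw [Finset.sum_add_distrib, ← Finset.mul_sum, ← Finset.mul_sum]
      calc _ ≤ β * (b * (1 - β)⁻¹ * ∑ n ∈ Finset.range m, (R.killed ^ n) x Set.univ)
            + ((1 - β) * (1 - β)⁻¹) * (b * ∑ n ∈ Finset.range m, (R.killed ^ n) x Set.univ) := by
            rw [ENNReal.mul_inv_cancel h0 h1, one_mul]
            gcongr
        _ = (β + (1 - β)) * (b * (1 - β)⁻¹ * ∑ n ∈ Finset.range m, (R.killed ^ n) x Set.univ) := by
            ring
        _ ≤ _ := by
            rw [add_tsub_cancel_of_le hβ.le, one_mul]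
            gcongr
            omega
  refine ENNReal.tsum_le_of_sum_range_le fun m => (key m).trans ?_
  gcongr
  exact ENNReal.sum_le_tsum _

variable [IsMarkovKernel P]

lemma killed_add {x : ℝ} (hx : x ∈ R.C) : R.killed x + ENNReal.ofReal R.δ • R.ν = P x := by
  have hν := R.prob_ν
  rw [killed_of_mem _ hx]
  rcases lt_or_eq_of_le R.δ.2.2 with hδ | hδ
  · ext E hE
    have h0 : 0 < 1 - (R.δ : ℝ) := sub_pos.2 hδ
    simp only [splitLaw, hx, if_true, Bool.false_eq_true, if_false, hδ, Measure.add_apply,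
      Measure.smul_apply, smul_eq_mul, R.residual_apply hx hE]
    rw [← mul_assoc, ENNReal.mul_inv_cancel (ENNReal.ofReal_pos.2 h0).ne' ENNReal.ofReal_ne_top,
      one_mul, tsub_add_cancel_of_le (R.minor x hx E hE)]
  · have h := R.smul_le hx
    rw [hδ] at h ⊢
    simp only [ENNReal.ofReal_one, one_smul, sub_self, ENNReal.ofReal_zero, zero_smul,
      zero_add] at h ⊢
    exact Measure.eq_of_le_of_isProbabilityMeasure h

lemma killed_le (x : ℝ) : R.killed x ≤ P x := by
  by_cases hx : x ∈ R.C
  · rw [← R.killed_add hx]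
    exact Measure.le_add_right le_rfl
  · rw [R.killed_of_notMem hx]

lemma killed_univ_add (x : ℝ) :
    R.killed x Set.univ + ENNReal.ofReal R.δ * R.C.indicator 1 x = 1 := by
  have hν := R.prob_ν
  by_cases hx : x ∈ R.C
  · have := congrArg (fun m : Measure ℝ => m Set.univ) (R.killed_add hx)
    simpa [hx] using this
  · simp [R.killed_of_notMem hx, hx]

lemma killed_pow_le (n : ℕ) (x : ℝ) : (R.killed ^ n) x ≤ (P ^ n) x := by
  induction n with
  | zero => simp
  | succ n ih =>
    refine Measure.le_iff.2 fun E hE => ?_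
    rw [pow_add_apply _ _ _ _ hE, pow_add_apply _ _ _ _ hE, pow_one, pow_one]
    exact lintegral_mono' ih fun y => R.killed_le y E

lemma killed_pow_univ_le_one (n : ℕ) (x : ℝ) : (R.killed ^ n) x Set.univ ≤ 1 :=
  (R.killed_pow_le n x Set.univ).trans (by simp)

lemma killed_pow_succ_univ_add (n : ℕ) (x : ℝ) :
    (R.killed ^ (n + 1)) x Set.univ + ENNReal.ofReal R.δ * (R.killed ^ n) x R.C
      = (R.killed ^ n) x Set.univ := by
  rw [pow_add_apply _ _ _ _ MeasurableSet.univ, pow_one, ← lintegral_indicator_one R.measurableSet_C,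
    ← lintegral_const_mul _ (measurable_one.indicator R.measurableSet_C),
    ← lintegral_add_left (Kernel.measurable_coe _ MeasurableSet.univ)]
  simp_rw [killed_univ_add]
  simp

lemma killed_pow_univ_antitone (x : ℝ) : Antitone fun n => (R.killed ^ n) x Set.univ :=
  antitone_nat_of_succ_le fun n => by
    rw [← R.killed_pow_succ_univ_add n x]; exact le_self_add

lemma pow_apply_add_killed_pow_univ_le (n : ℕ) (x : ℝ) {E : Set ℝ} (hE : MeasurableSet E) :
    (P ^ n) x E + (R.killed ^ n) x Set.univ ≤ (R.killed ^ n) x E + 1 := by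
  rw [← measure_add_measure_compl (μ := (R.killed ^ n) x) hE,
    ← measure_univ (μ := (P ^ n) x), ← measure_add_measure_compl (μ := (P ^ n) x) hE]
  calc _ ≤ (P ^ n) x E + ((R.killed ^ n) x E + (P ^ n) x Eᶜ) := by
        gcongr; exact R.killed_pow_le n x
    _ = _ := by ring

lemma killed_pow_succ_univ_add_le (n : ℕ) (x : ℝ) :
    (R.killed ^ (n + 1)) x Set.univ + ENNReal.ofReal R.δ * (P ^ n) x R.C ≤ 1 := by
  set d := ENNReal.ofReal R.δ with hd
  set d' := ENNReal.ofReal (1 - R.δ) with hd'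
  have hdd : d' + d = 1 := by
    rw [hd, hd', ← ENNReal.ofReal_add (sub_nonneg.2 R.δ.2.2) R.δ.2.1]; simp
  have hp := R.killed_pow_univ_le_one n x
  have h1 := R.pow_apply_add_killed_pow_univ_le n x R.measurableSet_C
  have hfin : d * (R.killed ^ n) x Set.univ ≠ ⊤ :=
    ENNReal.mul_ne_top ENNReal.ofReal_ne_top (ne_top_of_le_ne_top ENNReal.one_ne_top hp)
  refine (ENNReal.add_le_add_iff_right hfin).1 ?_
  calc (R.killed ^ (n + 1)) x Set.univ + d * (P ^ n) x R.C + d * (R.killed ^ n) x Set.univ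
      = (R.killed ^ (n + 1)) x Set.univ
        + d * ((P ^ n) x R.C + (R.killed ^ n) x Set.univ) := by ring
    _ ≤ (R.killed ^ (n + 1)) x Set.univ + d * ((R.killed ^ n) x R.C + 1) := by gcongr
    _ = (R.killed ^ n) x Set.univ + d := by
        rw [mul_add, mul_one, ← add_assoc, R.killed_pow_succ_univ_add]
    _ = (d' + d) * (R.killed ^ n) x Set.univ + d := by rw [hdd, one_mul]
    _ ≤ d' * 1 + d * (R.killed ^ n) x Set.univ + d := by
        rw [add_mul]; gcongr
    _ = 1 + d * (R.killed ^ n) x Set.univ := by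
        rw [mul_one, add_right_comm, hdd]

/-- The occupation of a set from which regeneration has a uniformly positive probability. -/
lemma tsum_killed_pow_le {K : Set ℝ} (hK : MeasurableSet K) {N : ℕ} {c : ℝ≥0∞}
    (h : ∀ x ∈ K, N * (R.killed ^ N) x Set.univ + c ≤ N) (x : ℝ) :
    c * ∑' n, (R.killed ^ n) x K ≤ N * N := by
  have step : ∀ n, N * (R.killed ^ (n + N)) x Set.univ + c * (R.killed ^ n) x K
      ≤ N * (R.killed ^ n) x Set.univ := by
    intro n
    have hm : Measurable fun y => (R.killed ^ N) y Set.univ :=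
      Kernel.measurable_coe _ MeasurableSet.univ
    rw [pow_add_apply _ _ _ _ MeasurableSet.univ, ← lintegral_const_mul _ hm,
      ← lintegral_indicator_one hK, ← lintegral_const_mul _ (measurable_one.indicator hK),
      ← lintegral_add_left (hm.const_mul _), ← lintegral_const]
    refine lintegral_mono fun y => ?_
    by_cases hy : y ∈ K
    · simpa [hy] using h y hy
    · simp only [hy, not_false_eq_true, Set.indicator_of_notMem, mul_zero, add_zero]
      exact (mul_le_mul_right (R.killed_pow_univ_le_one N y) _).trans_eq (mul_one _)
  rw [← ENNReal.tsum_mul_left]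
  refine ENNReal.tsum_le_of_sum_range_le fun m => ?_
  have hsum := Finset.sum_le_sum fun n (_ : n ∈ Finset.range m) => step n
  simp only [Finset.sum_add_distrib, ← Finset.mul_sum] at hsum
  simp only [← Finset.mul_sum]
  have hfin : (N : ℝ≥0∞) * ∑ n ∈ Finset.range m, (R.killed ^ (n + N)) x Set.univ ≠ ⊤ :=
    ENNReal.mul_ne_top (ENNReal.natCast_ne_top N) (ENNReal.sum_ne_top.2 fun n _ =>
      ne_top_of_le_ne_top ENNReal.one_ne_top (R.killed_pow_univ_le_one _ x))
  refine (ENNReal.add_le_add_iff_left hfin).1 (hsum.trans ?_)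
  rw [← mul_add]
  gcongr
  calc ∑ n ∈ Finset.range m, (R.killed ^ n) x Set.univ
      ≤ ∑ n ∈ Finset.range (N + m), (R.killed ^ n) x Set.univ :=
        Finset.sum_le_sum_of_subset (Finset.range_mono (by omega))
    _ = ∑ n ∈ Finset.range N, (R.killed ^ n) x Set.univ
        + ∑ n ∈ Finset.range m, (R.killed ^ (n + N)) x Set.univ := by
        rw [Finset.sum_range_add]
        simp_rw [add_comm N]
    _ ≤ _ := by
        rw [add_comm]
        gcongr
        refine (Finset.sum_le_sum fun n _ => R.killed_pow_univ_le_one n x).trans ?_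
        simp

lemma tsum_killed_pow_univ_le {W : ℝ → ℝ≥0∞} (hW : Measurable W) {K : Set ℝ} (hK : MeasurableSet K)
    {b : ℝ≥0∞} (h : ∀ x, ∫⁻ y, W y ∂(P x) + 1 ≤ W x + b * K.indicator 1 x) (x : ℝ) :
    ∑' n, (R.killed ^ n) x Set.univ ≤ W x + b * ∑' n, (R.killed ^ n) x K := by
  have key : ∀ m, ∫⁻ y, W y ∂((R.killed ^ m) x)
      + ∑ n ∈ Finset.range m, (R.killed ^ n) x Set.univ
      ≤ W x + b * ∑ n ∈ Finset.range m, (R.killed ^ n) x K := by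
    intro m
    induction m with
    | zero => rw [lintegral_pow_zero _ _ hW]; simp
    | succ m ih =>
      have h1 : ∫⁻ y, W y ∂((R.killed ^ (m + 1)) x) + (R.killed ^ m) x Set.univ
          ≤ ∫⁻ y, W y ∂((R.killed ^ m) x) + b * (R.killed ^ m) x K := by
        rw [lintegral_pow_succ' _ _ _ hW, ← lintegral_one, ← lintegral_add_right _ measurable_const,
          ← lintegral_indicator_one hK, ← lintegral_const_mul _ (measurable_one.indicator hK),
          ← lintegral_add_left hW]
        refine lintegral_mono fun y => le_trans ?_ (h y)
        gcongr
        exact R.killed_le y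
      rw [Finset.sum_range_succ, Finset.sum_range_succ, mul_add]
      calc _ = (∫⁻ y, W y ∂((R.killed ^ (m + 1)) x) + (R.killed ^ m) x Set.univ)
            + ∑ n ∈ Finset.range m, (R.killed ^ n) x Set.univ := by ring
        _ ≤ (∫⁻ y, W y ∂((R.killed ^ m) x) + b * (R.killed ^ m) x K)
            + ∑ n ∈ Finset.range m, (R.killed ^ n) x Set.univ := by gcongr
        _ = (∫⁻ y, W y ∂((R.killed ^ m) x) + ∑ n ∈ Finset.range m, (R.killed ^ n) x Set.univ)
            + b * (R.killed ^ m) x K := by ring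
        _ ≤ _ := by rw [← add_assoc]; gcongr
  refine ENNReal.tsum_le_of_sum_range_le fun m => (le_add_self.trans (key m)).trans ?_
  gcongr
  exact ENNReal.sum_le_tsum _

lemma lintegral_killed_pow_le {W : ℝ → ℝ≥0∞} (hW : Measurable W) {β b : ℝ≥0∞}
    (h : ∀ x, ∫⁻ y, W y ∂(P x) ≤ β * W x + b) (n : ℕ) (x : ℝ) :
    ∫⁻ y, W y ∂((R.killed ^ n) x) ≤ β ^ n * W x + R.inputSum β b x n := by
  induction n with
  | zero => rw [lintegral_pow_zero _ _ hW]; simp [inputSum]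
  | succ n ih =>
    rw [lintegral_pow_succ' _ _ _ hW, inputSum]
    calc ∫⁻ y, ∫⁻ z, W z ∂(R.killed y) ∂((R.killed ^ n) x)
        ≤ ∫⁻ y, (β * W y + b) ∂((R.killed ^ n) x) := by
          refine lintegral_mono fun y => le_trans ?_ (h y)
          exact lintegral_mono' (R.killed_le y) le_rfl
      _ = β * ∫⁻ y, W y ∂((R.killed ^ n) x) + b * (R.killed ^ n) x Set.univ := by
          rw [lintegral_add_right _ measurable_const, lintegral_const_mul _ hW, lintegral_const]
      _ ≤ β * (β ^ n * W x + R.inputSum β b x n) + b * (R.killed ^ n) x Set.univ := by gcongr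
      _ = _ := by ring

end Killed

variable {μ : Measure (ℝ × ℝ × ℝ)} [IsProbabilityMeasure μ] (R : Minorization (letacKernel μ))

lemma mul_killed_pow_univ_add_le {N : ℕ} {ε : ℝ≥0∞} {x : ℝ} (h : ε ≤ R.hitSum N x) :
    N * (R.killed ^ N) x Set.univ + ENNReal.ofReal R.δ * ε ≤ N := by
  calc N * (R.killed ^ N) x Set.univ + ENNReal.ofReal R.δ * ε
      ≤ ∑ n ∈ Finset.range N, (R.killed ^ (n + 1)) x Set.univ
        + ENNReal.ofReal R.δ * R.hitSum N x := by
        gcongr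
        rw [← nsmul_eq_mul, ← Finset.card_range N, ← Finset.sum_const, Finset.card_range]
        refine Finset.sum_le_sum fun n hn => R.killed_pow_univ_antitone x ?_
        exact Finset.mem_range.1 hn
    _ = ∑ n ∈ Finset.range N, ((R.killed ^ (n + 1)) x Set.univ
        + ENNReal.ofReal R.δ * (letacKernel μ ^ n) x R.C) := by
        rw [hitSum, Finset.mul_sum, Finset.sum_add_distrib]
    _ ≤ ∑ n ∈ Finset.range N, 1 := Finset.sum_le_sum fun n _ => R.killed_pow_succ_univ_add_le n x
    _ = N := by simp

end Minorization

section Slopes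

lemma eq_one_of_rpow_eq_one {x z : ℝ} (hx : 0 ≤ x) (hz : z ≠ 0) (h : x ^ z = 1) : x = 1 :=
  (Real.rpow_left_inj hx zero_le_one hz).1 (by rw [h, Real.one_rpow])

variable {μ : Measure (ℝ × ℝ × ℝ)} {ξ : ℝ}

lemma H1.not_ae_mem_countable (h1 : H1 μ ξ) {S : Set ℝ} (hS : S.Countable) :
    ¬ ∀ᵐ y ∂μ, y.1 ∈ S := by
  intro h
  refine h1.not_singular ⟨Sᶜ, hS.measurableSet.compl, ?_, ?_⟩
  · rw [Measure.map_apply measurable_fst hS.measurableSet.compl]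
    exact ae_iff.1 h
  · rw [compl_compl]
    exact hS.measure_zero _

lemma H1.integral_rpow_eq_one [IsProbabilityMeasure μ] (h1 : H1 μ ξ) (hA : ∀ᵐ y ∂μ, 0 < y.1) :
    ∫ y, y.1 ^ ξ ∂μ = 1 := by
  have hint : Integrable (fun y => y.1 ^ ξ) μ := h1.finite_near.self_of_nhds
  have h0 : 0 ≤ᵐ[μ] fun y => y.1 ^ ξ := by
    filter_upwards [hA] with y hy using Real.rpow_nonneg hy.le _
  have hroot := h1.root
  rw [logMoment, Real.log_eq_zero] at hroot
  rcases hroot with h | h | h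
  · rw [integral_eq_zero_iff_of_nonneg_ae h0 hint] at h
    obtain ⟨y, hy, hy'⟩ := (hA.and h).exists
    exact absurd hy' (Real.rpow_pos_of_pos hy _).ne'
  · exact h
  · linarith [integral_nonneg_of_ae h0]

lemma H1.integral_rpow_sub_one_eq_zero [IsProbabilityMeasure μ] (h1 : H1 μ ξ)
    (hA : ∀ᵐ y ∂μ, 0 < y.1) : ∫ y, (y.1 ^ ξ - 1) ∂μ = 0 := by
  rw [integral_sub h1.finite_near.self_of_nhds (integrable_const _), h1.integral_rpow_eq_one hA]
  simp

lemma H1.measure_one_lt_pos [IsProbabilityMeasure μ] (h1 : H1 μ ξ) (hA : ∀ᵐ y ∂μ, 0 < y.1) :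
    0 < μ {y | 1 < y.1} := by
  refine pos_iff_ne_zero.2 fun h0 => h1.not_ae_mem_countable (Set.countable_singleton 1) ?_
  have hle : ∀ᵐ y ∂μ, y.1 ≤ 1 := by rw [ae_iff]; simpa using h0
  have h := h1.integral_rpow_sub_one_eq_zero hA
  rw [← neg_eq_zero, ← integral_neg, integral_eq_zero_iff_of_nonneg_ae] at h
  · filter_upwards [h, hA] with y hy hpos
    have hy' : y.1 ^ ξ = 1 := by simp only [Pi.zero_apply] at hy; linarith
    exact eq_one_of_rpow_eq_one hpos.le h1.pos.ne' hy'
  · filter_upwards [hle, hA] with y hy hpos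
    simpa using Real.rpow_le_one hpos.le hy h1.pos.le
  · exact (h1.finite_near.self_of_nhds.sub (integrable_const _)).neg

lemma H1.measure_lt_one_pos [IsProbabilityMeasure μ] (h1 : H1 μ ξ) (hA : ∀ᵐ y ∂μ, 0 < y.1) :
    0 < μ {y | y.1 < 1} := by
  refine pos_iff_ne_zero.2 fun h0 => h1.not_ae_mem_countable (Set.countable_singleton 1) ?_
  have hle : ∀ᵐ y ∂μ, 1 ≤ y.1 := by rw [ae_iff]; simpa using h0
  have h := h1.integral_rpow_sub_one_eq_zero hA
  rw [integral_eq_zero_iff_of_nonneg_ae] at h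
  · filter_upwards [h, hA] with y hy hpos
    have hy' : y.1 ^ ξ = 1 := by simp only [Pi.zero_apply] at hy; linarith
    exact eq_one_of_rpow_eq_one hpos.le h1.pos.ne' hy'
  · filter_upwards [hle] with y hy
    simpa using Real.one_le_rpow hy h1.pos.le
  · exact h1.finite_near.self_of_nhds.sub (integrable_const _)

/-- `E[A ^ α]` as an extended real. -/
noncomputable def slopeMoment (μ : Measure (ℝ × ℝ × ℝ)) (α : ℝ) : ℝ≥0∞ :=
  ∫⁻ y, ENNReal.ofReal (y.1 ^ α) ∂μ

lemma rpow_le_one_add_rpow {x α ξ : ℝ} (hx : 0 ≤ x) (hα : 0 ≤ α) (h : α ≤ ξ) :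
    x ^ α ≤ 1 + x ^ ξ := by
  rcases le_total x 1 with h1 | h1
  · linarith [Real.rpow_le_one hx h1 hα, Real.rpow_nonneg hx ξ]
  · linarith [Real.rpow_le_rpow_of_exponent_le h1 h]

lemma H1.slopeMoment_lt_one [IsProbabilityMeasure μ] (h1 : H1 μ ξ) (hA : ∀ᵐ y ∂μ, 0 < y.1) {α : ℝ}
    (hα : 0 < α) (hαξ : α < ξ) : slopeMoment μ α < 1 := by
  have hint := h1.finite_near.self_of_nhds
  have hintα : Integrable (fun y => y.1 ^ α) μ := by
    refine Integrable.mono' ((integrable_const 1).add hint)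
      (measurable_fst.pow_const α).aestronglyMeasurable ?_
    filter_upwards [hA] with y hy
    rw [Real.norm_of_nonneg (Real.rpow_nonneg hy.le _)]
    exact rpow_le_one_add_rpow hy.le hα.le hαξ.le
  have hp1 : α / ξ < 1 := (div_lt_one h1.pos).2 hαξ
  have hp0 : 0 < α / ξ := div_pos hα h1.pos
  have hpow : ∀ y : ℝ × ℝ × ℝ, 0 < y.1 → y.1 ^ α = (1 + (y.1 ^ ξ - 1)) ^ (α / ξ) := by
    intro y hy
    rw [add_sub_cancel, ← Real.rpow_mul hy.le, mul_div_cancel₀ _ h1.pos.ne']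
  have hg0 : 0 ≤ᵐ[μ] fun y => 1 + α / ξ * (y.1 ^ ξ - 1) - y.1 ^ α := by
    filter_upwards [hA] with y hy
    have := rpow_one_add_le_one_add_mul_self (s := y.1 ^ ξ - 1)
      (by linarith [Real.rpow_nonneg hy.le ξ]) hp0.le hp1.le
    rw [← hpow y hy] at this
    simpa using this
  have hintL : Integrable (fun y => 1 + α / ξ * (y.1 ^ ξ - 1)) μ :=
    (integrable_const 1).add ((hint.sub (integrable_const 1)).const_mul _)
  have hsum : ∫ y, (1 + α / ξ * (y.1 ^ ξ - 1) - y.1 ^ α) ∂μ = 1 - ∫ y, y.1 ^ α ∂μ := by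
    have hintS : Integrable (fun y => α / ξ * (y.1 ^ ξ - 1)) μ :=
      (hint.sub (integrable_const 1)).const_mul _
    rw [integral_sub hintL hintα, integral_add (integrable_const 1) hintS, integral_const_mul,
      h1.integral_rpow_sub_one_eq_zero hA]
    simp
  have hlt : ∫ y, y.1 ^ α ∂μ < 1 := by
    have hnn := integral_nonneg_of_ae hg0
    rcases hnn.lt_or_eq with h | h
    · linarith [hsum ▸ h]
    · exfalso
      refine h1.not_ae_mem_countable (Set.countable_singleton 1) ?_
      have h' := (integral_eq_zero_iff_of_nonneg_ae hg0 (hintL.sub hintα)).1 h.symm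
      filter_upwards [h', hA] with y hy hpos
      by_contra hne
      have hs : y.1 ^ ξ - 1 ≠ 0 := fun h0 => hne
        (eq_one_of_rpow_eq_one hpos.le h1.pos.ne' (by linarith))
      have := rpow_one_add_lt_one_add_mul_self (s := y.1 ^ ξ - 1)
        (by linarith [Real.rpow_nonneg hpos.le ξ]) hs hp0 hp1
      rw [← hpow y hpos] at this
      simp only [Pi.zero_apply] at hy
      linarith
  rw [slopeMoment, ← ofReal_integral_eq_lintegral_ofReal hintα
    (by filter_upwards [hA] with y hy using Real.rpow_nonneg hy.le _), ← ENNReal.ofReal_one]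
  exact (ENNReal.ofReal_lt_ofReal_iff one_pos).2 hlt

/-- `E[(A |D|) ^ α] + E[|B| ^ α]` as an extended real. -/
noncomputable def inputMoment (μ : Measure (ℝ × ℝ × ℝ)) (α : ℝ) : ℝ≥0∞ :=
  ∫⁻ y, (ENNReal.ofReal ((y.1 * |y.2.2|) ^ α) + ENNReal.ofReal (|y.2.1| ^ α)) ∂μ

lemma H2.inputMoment_lt_top [IsProbabilityMeasure μ] (h2 : H2 μ ξ) (hA : ∀ᵐ y ∂μ, 0 < y.1) {α : ℝ}
    (hα : 0 ≤ α) (hαξ : α ≤ ξ) : inputMoment μ α < ⊤ := by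
  have h : Integrable (fun y : ℝ × ℝ × ℝ => (1 + (y.1 * |y.2.2|) ^ ξ) + (1 + |y.2.1| ^ ξ)) μ :=
    ((integrable_const 1).add h2.integrable_AD).add ((integrable_const 1).add h2.integrable_B)
  refine lt_of_le_of_lt (lintegral_mono_ae ?_) h.lintegral_lt_top
  filter_upwards [hA] with y hy
  have hD : 0 ≤ y.1 * |y.2.2| := by positivity
  rw [← ENNReal.ofReal_add (by positivity) (by positivity)]
  exact ENNReal.ofReal_le_ofReal
    (add_le_add (rpow_le_one_add_rpow hD hα hαξ) (rpow_le_one_add_rpow (abs_nonneg _) hα hαξ))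

/-- The function `|x| ^ α`. -/
noncomputable def absPow (α x : ℝ) : ℝ≥0∞ := ENNReal.ofReal (|x| ^ α)

lemma measurable_absPow (α : ℝ) : Measurable (absPow α) := by
  unfold absPow; fun_prop

lemma absPow_letacMap_le {α : ℝ} (hα : 0 < α) (hα1 : α ≤ 1) {y : ℝ × ℝ × ℝ} (hy : 0 < y.1) (x : ℝ) :
    absPow α (letacMap y x) ≤ ENNReal.ofReal (y.1 ^ α) * absPow α x
      + (ENNReal.ofReal ((y.1 * |y.2.2|) ^ α) + ENNReal.ofReal (|y.2.1| ^ α)) := by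
  unfold absPow letacMap
  rw [← ENNReal.ofReal_mul (by positivity), ← ENNReal.ofReal_add (by positivity) (by positivity),
    ← ENNReal.ofReal_add (by positivity) (by positivity)]
  refine ENNReal.ofReal_le_ofReal ?_
  have hmax : |max y.2.2 x| ≤ |x| + |y.2.2| := by
    rcases max_choice y.2.2 x with h | h <;> rw [h] <;> linarith [abs_nonneg x, abs_nonneg y.2.2]
  have habs : |y.1 * max y.2.2 x + y.2.1| ≤ y.1 * |x| + (y.1 * |y.2.2| + |y.2.1|) := by
    refine (abs_add_le _ _).trans ?_
    rw [abs_mul, abs_of_pos hy]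
    nlinarith
  calc |y.1 * max y.2.2 x + y.2.1| ^ α ≤ (y.1 * |x| + (y.1 * |y.2.2| + |y.2.1|)) ^ α :=
        Real.rpow_le_rpow (abs_nonneg _) habs hα.le
    _ ≤ (y.1 * |x|) ^ α + (y.1 * |y.2.2| + |y.2.1|) ^ α :=
        Real.rpow_add_le_add_rpow (by positivity) (by positivity) hα.le hα1
    _ ≤ (y.1 * |x|) ^ α + ((y.1 * |y.2.2|) ^ α + |y.2.1| ^ α) := by
        gcongr
        exact Real.rpow_add_le_add_rpow (by positivity) (by positivity) hα.le hα1
    _ = _ := by rw [Real.mul_rpow hy.le (abs_nonneg _)]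

lemma lintegral_absPow_letacKernel_le [IsProbabilityMeasure μ] (hA : ∀ᵐ y ∂μ, 0 < y.1) {α : ℝ}
    (hα : 0 < α) (hα1 : α ≤ 1) (x : ℝ) :
    ∫⁻ z, absPow α z ∂(letacKernel μ x) ≤ slopeMoment μ α * absPow α x + inputMoment μ α := by
  rw [lintegral_letacKernel _ (measurable_absPow α), slopeMoment, inputMoment,
    ← lintegral_mul_const _ (by fun_prop), ← lintegral_add_left (by fun_prop)]
  refine lintegral_mono_ae ?_
  filter_upwards [hA] with y hy using absPow_letacMap_le hα hα1 hy x

end Slopes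

namespace Minorization

variable {μ : Measure (ℝ × ℝ × ℝ)} [IsProbabilityMeasure μ] (R : Minorization (letacKernel μ))

/-- The mean regeneration time grows at most like `|x| ^ α`. -/
lemma exists_tsum_killed_pow_univ_le {ξ : ℝ} (hA : ∀ᵐ y ∂μ, 0 < y.1) (h1 : H1 μ ξ) (h2 : H2 μ ξ)
    {α : ℝ} (hα : 0 < α) (hα1 : α ≤ 1) (hαξ : α < ξ) :
    ∃ c : ℝ≥0∞, c < ⊤ ∧ ∀ x, ∑' n, (R.killed ^ n) x Set.univ ≤ absPow α x + c := by
  set β := slopeMoment μ α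
  set b := inputMoment μ α
  have hβ : β < 1 := h1.slopeMoment_lt_one hA hα hαξ
  have hb : b < ⊤ := h2.inputMoment_lt_top hA hα.le hαξ.le
  have hβ0 : 1 - β ≠ 0 := (tsub_pos_of_lt hβ).ne'
  have hβ1 : 1 - β ≠ ⊤ := ne_top_of_le_ne_top ENNReal.one_ne_top tsub_le_self
  have hlev : (b + 1) * (1 - β)⁻¹ ≠ ⊤ :=
    ENNReal.mul_ne_top (by simp [hb.ne]) (ENNReal.inv_ne_top.2 hβ0)
  set t := ((b + 1) * (1 - β)⁻¹).toReal with ht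
  set M := t ^ (1 / α) with hM
  have ht0 : 0 ≤ t := ENNReal.toReal_nonneg
  obtain ⟨N, ε, hε, hN⟩ := R.exists_le_hitSum hA (h1.measure_one_lt_pos hA)
    (h1.measure_lt_one_pos hA) (fun _ hS => h1.not_ae_mem_countable hS) M
  have hK : MeasurableSet {x : ℝ | |x| ≤ M} := measurableSet_le (by fun_prop) measurable_const
  have hocc := R.tsum_killed_pow_le hK fun x hx => R.mul_killed_pow_univ_add_le (hN x hx)
  set d := ENNReal.ofReal R.δ * ε
  have hd : d ≠ 0 := mul_ne_zero R.ofReal_δ_pos.ne' hε.ne'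
  have hdrift : ∀ x, ∫⁻ y, absPow α y ∂(letacKernel μ x) + 1
      ≤ absPow α x + (b + 1) * {x : ℝ | |x| ≤ M}.indicator 1 x := by
    intro x
    have h0 := lintegral_absPow_letacKernel_le (μ := μ) hA hα hα1 x
    by_cases hx : |x| ≤ M
    · rw [Set.indicator_of_mem (show x ∈ {x : ℝ | |x| ≤ M} from hx)]
      calc _ ≤ β * absPow α x + b + 1 := by gcongr
        _ ≤ 1 * absPow α x + b + 1 := by gcongr
        _ = _ := by simp [add_assoc]
    · rw [Set.indicator_of_notMem (show x ∉ {x : ℝ | |x| ≤ M} from hx), mul_zero, add_zero]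
      have hx' : (b + 1) * (1 - β)⁻¹ ≤ absPow α x := by
        rw [← ENNReal.ofReal_toReal hlev, ← ht, absPow]
        refine ENNReal.ofReal_le_ofReal ?_
        have : M ^ α ≤ |x| ^ α :=
          Real.rpow_le_rpow (Real.rpow_nonneg ht0 _) (not_le.1 hx).le hα.le
        rwa [hM, ← Real.rpow_mul ht0, one_div_mul_cancel hα.ne', Real.rpow_one] at this
      have hx'' : b + 1 ≤ (1 - β) * absPow α x := by
        calc b + 1 = (1 - β) * ((b + 1) * (1 - β)⁻¹) := by
              rw [mul_left_comm, ENNReal.mul_inv_cancel hβ0 hβ1, mul_one]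
          _ ≤ _ := by gcongr
      calc _ ≤ β * absPow α x + b + 1 := by gcongr
        _ = β * absPow α x + (b + 1) := add_assoc _ _ _
        _ ≤ β * absPow α x + (1 - β) * absPow α x := by gcongr
        _ = absPow α x := by rw [← add_mul, add_tsub_cancel_of_le hβ.le, one_mul]
  refine ⟨(b + 1) * (N * N / d), ENNReal.mul_lt_top (by simp [hb])
    (ENNReal.div_lt_top (ENNReal.mul_ne_top (by simp) (by simp)) hd), fun x => ?_⟩
  refine (R.tsum_killed_pow_univ_le (measurable_absPow α) hK hdrift x).trans ?_
  gcongr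
  rw [ENNReal.le_div_iff_mul_le (Or.inl hd) (Or.inr (ENNReal.mul_ne_top (by simp) (by simp))),
    mul_comm]
  exact hocc x

end Minorization

section ConvPow

instance isProbabilityMeasure_convPow (m : Measure ℝ) [IsProbabilityMeasure m] (n : ℕ) :
    IsProbabilityMeasure (convPow m n) := by
  induction n with
  | zero => rw [convPow]; infer_instance
  | succ n ih => rw [convPow]; infer_instance

lemma convPow_succ_apply (m : Measure ℝ) [IsProbabilityMeasure m] (n : ℕ) {E : Set ℝ}
    (hE : MeasurableSet E) :
    convPow m (n + 1) E = ∫⁻ s, convPow m n ((fun x => x + s) ⁻¹' E) ∂m := by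
  rw [convPow, Measure.conv, Measure.map_apply (by fun_prop) hE,
    Measure.prod_apply_symm (hE.preimage (by fun_prop))]
  rfl

variable {μ : Measure (ℝ × ℝ × ℝ)} [IsProbabilityMeasure μ]

instance isProbabilityMeasure_negLogLaw : IsProbabilityMeasure (negLogLaw μ) :=
  Measure.isProbabilityMeasure_map (by fun_prop)

lemma measurable_convPow_preimage_add (m : Measure ℝ) [IsProbabilityMeasure m] (n : ℕ) {E : Set ℝ}
    (hE : MeasurableSet E) : Measurable fun s => convPow m n ((fun x => x + s) ⁻¹' E) :=
  measurable_measure_prodMk_right (μ := convPow m n)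
    (s := (fun p : ℝ × ℝ => p.1 + p.2) ⁻¹' E) (hE.preimage (by fun_prop))

lemma convPow_negLogLaw_succ_apply (n : ℕ) {E : Set ℝ} (hE : MeasurableSet E) :
    convPow (negLogLaw μ) (n + 1) E
      = ∫⁻ y, convPow (negLogLaw μ) n ((fun x => x + -Real.log y.1) ⁻¹' E) ∂μ := by
  rw [convPow_succ_apply _ _ hE]
  exact lintegral_map (measurable_convPow_preimage_add _ n hE) (by fun_prop)

lemma convPow_negLogLaw_succ_Iio (n : ℕ) (z : ℝ) :
    convPow (negLogLaw μ) (n + 1) (Set.Iio z)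
      = ∫⁻ y, convPow (negLogLaw μ) n (Set.Iio (z + Real.log y.1)) ∂μ := by
  rw [convPow_negLogLaw_succ_apply n measurableSet_Iio]
  congr! 3 with y
  ext x
  simp [← sub_eq_add_neg]

lemma ae_convPow_singleton_eq_zero {n : ℕ} {z : ℝ}
    (h : convPow (negLogLaw μ) (n + 1) {z} = 0) :
    ∀ᵐ y ∂μ, convPow (negLogLaw μ) n {z + Real.log y.1} = 0 := by
  rw [convPow_negLogLaw_succ_apply n (measurableSet_singleton z)] at h
  have hm : Measurable fun y : ℝ × ℝ × ℝ =>
      convPow (negLogLaw μ) n ((fun x => x + -Real.log y.1) ⁻¹' {z}) :=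
    (measurable_convPow_preimage_add _ n (measurableSet_singleton z)).comp (by fun_prop)
  filter_upwards [(lintegral_eq_zero_iff hm).1 h] with y hy
  rw [← show _ = (0 : ℝ≥0∞) from hy]
  congr 1
  ext x
  simp [← sub_eq_add_neg, sub_eq_iff_eq_add]

lemma convPow_Iio_le (hA : ∀ᵐ y ∂μ, 0 < y.1) {α : ℝ} (hα : 0 ≤ α) (n : ℕ) (z : ℝ) :
    convPow (negLogLaw μ) n (Set.Iio z) ≤ ENNReal.ofReal (Real.exp (α * z)) * slopeMoment μ α ^ n := by
  induction n generalizing z with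
  | zero =>
    rw [convPow, Measure.dirac_apply' _ measurableSet_Iio, pow_zero, mul_one]
    by_cases hz : 0 < z
    · simpa [hz] using mul_nonneg hα hz.le
    · simp [hz]
  | succ n ih =>
    rw [convPow_negLogLaw_succ_Iio]
    calc _ ≤ ∫⁻ y, (ENNReal.ofReal (Real.exp (α * z)) * slopeMoment μ α ^ n)
            * ENNReal.ofReal (y.1 ^ α) ∂μ := by
          refine lintegral_mono_ae ?_
          filter_upwards [hA] with y hy
          refine (ih _).trans (le_of_eq ?_)
          rw [mul_add, Real.exp_add, ENNReal.ofReal_mul (Real.exp_pos _).le,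
            Real.rpow_def_of_pos hy, mul_comm (Real.log y.1)]
          ring
      _ = _ := by
          rw [lintegral_const_mul _ (by fun_prop), ← slopeMoment]
          ring

lemma tendsto_letacMap_div (y : ℝ × ℝ × ℝ) {w : ℝ → ℝ} {c : ℝ} (hc : 0 < c)
    (hw : Tendsto (fun u => w u / u) atTop (𝓝 c)) :
    Tendsto (fun u => letacMap y (w u) / u) atTop (𝓝 (y.1 * c)) := by
  have hD : Tendsto (fun u : ℝ => y.2.2 / u) atTop (𝓝 0) := tendsto_const_nhds.div_atTop tendsto_id
  have hB : Tendsto (fun u : ℝ => y.2.1 / u) atTop (𝓝 0) := tendsto_const_nhds.div_atTop tendsto_id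
  have h := ((hD.max hw).const_mul y.1).add hB
  rw [max_eq_right hc.le, add_zero] at h
  refine h.congr' ?_
  filter_upwards [eventually_gt_atTop 0] with u hu
  rw [letacMap, add_div, mul_div_assoc, max_div_div_right hu.le]

/-- Far from the origin the chain behaves like the multiplicative random walk. -/
lemma tendsto_letacKernel_pow_Ioi (hA : ∀ᵐ y ∂μ, 0 < y.1) (n : ℕ) {w : ℝ → ℝ} {c : ℝ} (hc : 0 < c)
    (hw : Tendsto (fun u => w u / u) atTop (𝓝 c))
    (hatom : convPow (negLogLaw μ) n {Real.log c} = 0) :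
    Tendsto (fun u => (letacKernel μ ^ n) (w u) (Set.Ioi u)) atTop
      (𝓝 (convPow (negLogLaw μ) n (Set.Iio (Real.log c)))) := by
  induction n generalizing w c with
  | zero =>
    simp only [pow_zero_apply _ _ measurableSet_Ioi]
    rw [convPow, Measure.dirac_apply' _ (measurableSet_singleton _)] at hatom
    rw [convPow, Measure.dirac_apply' _ measurableSet_Iio]
    have hne : Real.log c ≠ 0 := by
      intro h0
      simp [h0] at hatom
    rcases lt_or_gt_of_ne hne with h | h
    · have hc1 : c < 1 := (Real.log_neg_iff hc).1 h
      refine tendsto_const_nhds.congr' ?_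
      filter_upwards [hw.eventually (gt_mem_nhds hc1), eventually_gt_atTop 0] with u hu hu0
      rw [div_lt_one hu0] at hu
      simp [hu.le, h.le]
    · have hc1 : 1 < c := (Real.log_pos_iff hc.le).1 h
      refine tendsto_const_nhds.congr' ?_
      filter_upwards [hw.eventually (lt_mem_nhds hc1), eventually_gt_atTop 0] with u hu hu0
      rw [one_lt_div hu0] at hu
      simp [hu, h]
  | succ n ih =>
    simp only [letacKernel_pow_succ_apply _ _ measurableSet_Ioi]
    rw [convPow_negLogLaw_succ_Iio]
    refine tendsto_lintegral_filter_of_dominated_convergence (fun _ => 1)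
      (Eventually.of_forall fun u => (Kernel.measurable_coe _ measurableSet_Ioi).comp
        (measurable_letacMap_left _)) (Eventually.of_forall fun u => ae_of_all _ fun y => prob_le_one)
      (by simp) ?_
    filter_upwards [hA, ae_convPow_singleton_eq_zero hatom] with y hy hy'
    rw [add_comm, ← Real.log_mul hy.ne' hc.ne'] at hy' ⊢
    exact ih (mul_pos hy hc) (tendsto_letacMap_div y hc hw) hy'

lemma tendsto_letacKernel_pow_Iic (hA : ∀ᵐ y ∂μ, 0 < y.1) (n : ℕ) (K : ℝ) {w : ℝ → ℝ}
    (hw : Tendsto w atTop atTop) :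
    Tendsto (fun u => (letacKernel μ ^ n) (w u) (Set.Iic K)) atTop (𝓝 0) := by
  induction n generalizing w with
  | zero =>
    simp only [pow_zero_apply _ _ measurableSet_Iic]
    refine tendsto_const_nhds.congr' ?_
    filter_upwards [hw.eventually_gt_atTop K] with u hu
    simp [hu]
  | succ n ih =>
    simp only [letacKernel_pow_succ_apply _ _ measurableSet_Iic]
    rw [← lintegral_zero (μ := μ)]
    refine tendsto_lintegral_filter_of_dominated_convergence (fun _ => 1)
      (Eventually.of_forall fun u => (Kernel.measurable_coe _ measurableSet_Iic).comp
        (measurable_letacMap_left _)) (Eventually.of_forall fun u => ae_of_all _ fun y => prob_le_one)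
      (by simp) ?_
    filter_upwards [hA] with y hy
    refine ih ?_
    refine tendsto_atTop_mono (fun u => ?_) (tendsto_atTop_add_const_right _ y.2.1
      (hw.const_mul_atTop hy))
    unfold letacMap
    gcongr
    exact le_max_right _ _

end ConvPow

namespace Minorization

lemma pow_apply_le_killed_pow_add {P : Kernel ℝ ℝ} [IsMarkovKernel P] (R : Minorization P)
    (n : ℕ) (x : ℝ) {E : Set ℝ} (hE : MeasurableSet E) :
    (P ^ n) x E ≤ (R.killed ^ n) x E + ∑ i ∈ Finset.range n, (P ^ i) x R.C := by
  have h1 : 1 ≤ (R.killed ^ n) x Set.univ + ∑ i ∈ Finset.range n, (P ^ i) x R.C := by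
    induction n with
    | zero => rw [pow_zero_apply _ _ MeasurableSet.univ]; simp
    | succ n ih =>
      refine ih.trans ?_
      rw [Finset.sum_range_succ, add_comm (∑ i ∈ Finset.range n, _), ← add_assoc,
        ← R.killed_pow_succ_univ_add n x]
      gcongr
      calc ENNReal.ofReal R.δ * (R.killed ^ n) x R.C ≤ 1 * (P ^ n) x R.C := by
            gcongr
            · exact ENNReal.ofReal_le_one.2 R.δ.2.2
            · exact R.killed_pow_le n x
        _ = _ := one_mul _
  refine (ENNReal.add_le_add_iff_right ENNReal.one_ne_top).1 ?_
  calc (P ^ n) x E + 1 ≤ (P ^ n) x E + ((R.killed ^ n) x Set.univ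
        + ∑ i ∈ Finset.range n, (P ^ i) x R.C) := by gcongr
    _ ≤ ((R.killed ^ n) x E + 1) + ∑ i ∈ Finset.range n, (P ^ i) x R.C := by
        rw [← add_assoc]
        refine add_le_add_left ?_ _
        exact R.pow_apply_add_killed_pow_univ_le n x hE
    _ = _ := by ring

variable {μ : Measure (ℝ × ℝ × ℝ)} [IsProbabilityMeasure μ] (R : Minorization (letacKernel μ))

lemma tendsto_killed_pow_Ioi (hA : ∀ᵐ y ∂μ, 0 < y.1) (n : ℕ) {v : ℝ} (hv : 0 < v)
    (hatom : convPow (negLogLaw μ) n {Real.log v} = 0) :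
    Tendsto (fun u => (R.killed ^ n) (v * u) (Set.Ioi u)) atTop
      (𝓝 (convPow (negLogLaw μ) n (Set.Iio (Real.log v)))) := by
  have hw : Tendsto (fun u : ℝ => v * u / u) atTop (𝓝 v) := by
    refine tendsto_const_nhds.congr' ?_
    filter_upwards [eventually_ne_atTop 0] with u hu
    field_simp
  have hP := tendsto_letacKernel_pow_Ioi hA n hv hw hatom
  have hC : Tendsto (fun u => ∑ i ∈ Finset.range n, (letacKernel μ ^ i) (v * u) R.C) atTop (𝓝 0) := by
    obtain ⟨K, hK⟩ := R.bounded_C.bddAbove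
    rw [← Finset.sum_const_zero (s := Finset.range n)]
    refine tendsto_finsetSum _ fun i _ => ?_
    refine tendsto_of_tendsto_of_tendsto_of_le_of_le tendsto_const_nhds
      (tendsto_letacKernel_pow_Iic hA i K (tendsto_id.const_mul_atTop hv)) (fun _ => zero_le)
      fun u => measure_mono fun z hz => hK hz
  have hsub := ENNReal.Tendsto.sub hP hC (Or.inr ENNReal.zero_ne_top)
  rw [tsub_zero] at hsub
  refine tendsto_of_tendsto_of_tendsto_of_le_of_le hsub hP (fun u => ?_) fun u =>
    R.killed_pow_le n _ _
  exact tsub_le_iff_right.2 (R.pow_apply_le_killed_pow_add n _ measurableSet_Ioi)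

end Minorization

namespace Minorization

variable {P : Kernel ℝ ℝ} (R : Minorization P)

/-- The paths without regeneration before time `n`. -/
def alive (n : ℕ) : Set (ℕ → ℝ × Bool) :=
  {ω | ∀ k < n, ¬((ω k).1 ∈ R.C ∧ (ω k).2 = true)}

lemma lt_regenTime_iff (n : ℕ) (ω : ℕ → ℝ × Bool) :
    (n : ℕ∞) < R.regenTime ω ↔ ω ∈ R.alive n := by
  rw [← ENat.add_one_le_iff (ENat.natCast_ne_top n), regenTime, le_iInf₂_iff]
  constructor
  · intro h k hk hreg
    have := h k hreg
    norm_cast at this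
    omega
  · intro h k hreg
    norm_cast
    by_contra hk
    exact h k (by omega) hreg

lemma measurableSet_regen : MeasurableSet {s : ℝ × Bool | s.1 ∈ R.C ∧ s.2 = true} :=
  (measurable_fst R.measurableSet_C).inter (measurable_snd (measurableSet_singleton true))

lemma measurableSet_alive (n : ℕ) : MeasurableSet (R.alive n) := by
  have : R.alive n = ⋂ k, ⋂ (_ : k < n),
      (fun ω : ℕ → ℝ × Bool => ω k) ⁻¹' {s : ℝ × Bool | s.1 ∈ R.C ∧ s.2 = true}ᶜ := by
    ext ω; simp [alive]
  rw [this]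
  exact MeasurableSet.iInter fun k => MeasurableSet.iInter fun _ =>
    (measurable_pi_apply k) R.measurableSet_regen.compl

lemma lintegral_bernoulliMeasure (δ : I) (f : Bool → ℝ≥0∞) :
    ∫⁻ b, f b ∂(bernoulliMeasure true false δ)
      = ENNReal.ofReal δ * f true + ENNReal.ofReal (1 - δ) * f false := by
  have h : ∀ p : I, ((unitInterval.toNNReal p : ℝ≥0) : ℝ≥0∞) = ENNReal.ofReal p := fun p => by
    rw [ENNReal.ofReal, ENNReal.coe_inj]
    ext
    simp [p.2.1]
  rw [bernoulliMeasure_def, lintegral_add_measure, lintegral_smul_measure, lintegral_smul_measure,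
    lintegral_dirac, lintegral_dirac, ENNReal.smul_def, ENNReal.smul_def, h, h, smul_eq_mul,
    smul_eq_mul, unitInterval.coe_symm_eq]

lemma lintegral_bernoulliMeasure_splitLaw (y : ℝ) {G : ℝ → ℝ≥0∞} :
    ∫⁻ b, {s : ℝ × Bool | s.1 ∈ R.C ∧ s.2 = true}ᶜ.indicator
        (fun s => ∫⁻ z, G z ∂(R.splitLaw s)) (y, b) ∂(bernoulliMeasure true false R.δ)
      = ∫⁻ z, G z ∂(R.killed y) := by
  rw [lintegral_bernoulliMeasure]
  by_cases hy : y ∈ R.C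
  · rw [R.killed_of_mem hy, lintegral_smul_measure]
    simp [hy]
  · rw [R.killed_of_notMem hy]
    have : ENNReal.ofReal R.δ + ENNReal.ofReal (1 - R.δ) = 1 := by
      rw [← ENNReal.ofReal_add R.δ.2.1 (sub_nonneg.2 R.δ.2.2)]; simp
    simp [hy, splitLaw, ← add_mul, this]

variable [IsMarkovKernel P]

instance isProbabilityMeasure_splitLaw (s : ℝ × Bool) : IsProbabilityMeasure (R.splitLaw s) := by
  have hν := R.prob_ν
  refine ⟨?_⟩
  unfold splitLaw
  split_ifs with h _ hδ
  · exact measure_univ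
  · rw [R.residual_apply h MeasurableSet.univ, measure_univ, measure_univ, mul_one,
      ← ENNReal.ofReal_one, ← ENNReal.ofReal_sub _ R.δ.2.1]
    have h0 : 0 < 1 - (R.δ : ℝ) := sub_pos.2 hδ
    exact (ENNReal.inv_mul_cancel (ENNReal.ofReal_pos.2 h0).ne' ENNReal.ofReal_ne_top).trans
      ENNReal.ofReal_one.symm
  · exact measure_univ
  · exact measure_univ

lemma lintegral_splitKernel (s : ℝ × Bool) {g : ℝ × Bool → ℝ≥0∞} (hg : Measurable g) :
    ∫⁻ t, g t ∂(R.splitKernel s)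
      = ∫⁻ z, ∫⁻ b, g (z, b) ∂(bernoulliMeasure true false R.δ) ∂(R.splitLaw s) := by
  have hm : IsMarkovKernel (⟨R.splitLaw, R.measurable_splitLaw⟩ : Kernel (ℝ × Bool) ℝ) :=
    ⟨fun s => R.isProbabilityMeasure_splitLaw s⟩
  rw [splitKernel, Kernel.prod_apply, Kernel.const_apply, lintegral_prod _ hg.aemeasurable]
  rfl

lemma lintegral_pathLaw_zero (x : ℝ) {g : ℝ × Bool → ℝ≥0∞} (hg : Measurable g) :
    ∫⁻ ω, g (ω 0) ∂(R.pathLaw x) = ∫⁻ b, g (x, b) ∂(bernoulliMeasure true false R.δ) := by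
  let κ : (n : ℕ) → Kernel ((i : Finset.Iic n) → ℝ × Bool) (ℝ × Bool) := fun n =>
    R.splitKernel.comap
      (fun h : (i : Finset.Iic n) → ℝ × Bool => h ⟨n, Finset.mem_Iic.2 le_rfl⟩)
      (measurable_pi_apply _)
  have hκ : ∀ n, IsMarkovKernel (κ n) := fun n => by dsimp only [κ]; infer_instance
  have h0 : ∀ h : (i : Finset.Iic 0) → ℝ × Bool,
      ∫⁻ ω, g (ω 0) ∂(Kernel.traj (X := fun _ => ℝ × Bool) κ 0 h)
        = g (h ⟨0, Finset.mem_Iic.2 le_rfl⟩) := by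
    intro h
    have hm : Measurable fun h : (i : Finset.Iic 0) → ℝ × Bool =>
        g (h ⟨0, Finset.mem_Iic.2 le_rfl⟩) := hg.comp (measurable_pi_apply _)
    have h1 := Kernel.traj_map_frestrictLe_of_le (X := fun _ => ℝ × Bool) (κ := κ) (le_refl 0)
    have h2 := congrArg (fun k => ∫⁻ h, g (h ⟨0, Finset.mem_Iic.2 le_rfl⟩) ∂(k h)) h1
    rw [Kernel.lintegral_map _ (by fun_prop) _ hm, Kernel.lintegral_deterministic' _ hm] at h2
    exact h2
  have hm0 : Measurable fun ω : ℕ → ℝ × Bool => g (ω 0) := hg.comp (measurable_pi_apply 0)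
  change ∫⁻ ω, g (ω 0) ∂(Kernel.traj (X := fun _ => ℝ × Bool) κ 0 ∘ₘ
    (((Measure.dirac x).prod (bernoulliMeasure true false R.δ)).map
      (MeasurableEquiv.piUnique _).symm)) = _
  rw [Measure.lintegral_bind (Kernel.aemeasurable _) hm0.aemeasurable]
  simp_rw [h0]
  have hm1 : Measurable fun h : (i : Finset.Iic 0) → ℝ × Bool =>
    g (h ⟨0, Finset.mem_Iic.2 le_rfl⟩) := hg.comp (measurable_pi_apply _)
  rw [lintegral_map hm1 (by fun_prop), Measure.dirac_prod, lintegral_map _ (by fun_prop)]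
  · rfl
  · exact hm1.comp (by fun_prop)

instance isProbabilityMeasure_pathLaw (x : ℝ) : IsProbabilityMeasure (R.pathLaw x) := by
  unfold pathLaw; infer_instance

lemma lintegral_pathLaw_succ (x : ℝ) (n : ℕ) {g : ℝ × Bool → ℝ≥0∞} (hg : Measurable g) :
    ∫⁻ ω, (R.alive (n + 1)).indicator (fun ω => g (ω (n + 1))) ω ∂(R.pathLaw x)
      = ∫⁻ ω, (R.alive (n + 1)).indicator
          (fun ω => ∫⁻ t, g t ∂(R.splitKernel (ω n))) ω ∂(R.pathLaw x) := by
  let κ : (n : ℕ) → Kernel ((i : Finset.Iic n) → ℝ × Bool) (ℝ × Bool) := fun n =>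
    R.splitKernel.comap
      (fun h : (i : Finset.Iic n) → ℝ × Bool => h ⟨n, Finset.mem_Iic.2 le_rfl⟩)
      (measurable_pi_apply _)
  have hκ : ∀ n, IsMarkovKernel (κ n) := fun n => by dsimp only [κ]; infer_instance
  have key := Kernel.map_frestrictLe_trajMeasure_compProd_eq_map_trajMeasure
    (X := fun _ => ℝ × Bool) (κ := κ) (a := n)
    (μ₀ := (Measure.dirac x).prod (bernoulliMeasure true false R.δ))
  change (R.pathLaw x).map _ ⊗ₘ κ n = (R.pathLaw x).map _ at key
  let S : Set ((i : Finset.Iic n) → ℝ × Bool) :=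
    {h | ∀ k, ¬((h k).1 ∈ R.C ∧ (h k).2 = true)}
  have hS : MeasurableSet S := by
    have : S = ⋂ k, (fun h : (i : Finset.Iic n) → ℝ × Bool => h k) ⁻¹'
        {s : ℝ × Bool | s.1 ∈ R.C ∧ s.2 = true}ᶜ := by
      ext h; simp [S]
    rw [this]
    exact MeasurableSet.iInter fun k => (measurable_pi_apply k) R.measurableSet_regen.compl
  have hmem : ∀ ω : ℕ → ℝ × Bool, Preorder.frestrictLe n ω ∈ S ↔ ω ∈ R.alive (n + 1) := by
    intro ω
    constructor
    · intro h k hk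
      exact h ⟨k, Finset.mem_Iic.2 (by omega)⟩
    · intro h k
      exact h k.1 (by have := Finset.mem_Iic.1 k.2; omega)
  let F : ((i : Finset.Iic n) → ℝ × Bool) × (ℝ × Bool) → ℝ≥0∞ := fun p =>
    (Prod.fst ⁻¹' S).indicator (fun p => g p.2) p
  have hF : Measurable F := (hg.comp measurable_snd).indicator (measurable_fst hS)
  have h1 := congrArg (fun m => ∫⁻ p, F p ∂m) key
  rw [lintegral_map hF (by fun_prop), Measure.lintegral_compProd hF, lintegral_map
    hF.lintegral_kernel_prod_right' (by fun_prop)] at h1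
  have e1 : ∀ ω : ℕ → ℝ × Bool, F (Preorder.frestrictLe n ω, ω (n + 1))
      = (R.alive (n + 1)).indicator (fun ω => g (ω (n + 1))) ω := by
    intro ω
    by_cases h : ω ∈ R.alive (n + 1)
    · rw [Set.indicator_of_mem h]
      exact Set.indicator_of_mem (s := Prod.fst ⁻¹' S) ((hmem ω).2 h) _
    · rw [Set.indicator_of_notMem h]
      exact Set.indicator_of_notMem (s := Prod.fst ⁻¹' S) (fun h' => h ((hmem ω).1 h')) _
  have e2 : ∀ ω : ℕ → ℝ × Bool, ∫⁻ t, F (Preorder.frestrictLe n ω, t) ∂(κ n (Preorder.frestrictLe n ω))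
      = (R.alive (n + 1)).indicator (fun ω => ∫⁻ t, g t ∂(R.splitKernel (ω n))) ω := by
    intro ω
    by_cases h : ω ∈ R.alive (n + 1)
    · rw [Set.indicator_of_mem h]
      refine lintegral_congr fun t => ?_
      exact Set.indicator_of_mem (s := Prod.fst ⁻¹' S) ((hmem ω).2 h) _
    · rw [Set.indicator_of_notMem h, ← lintegral_zero (μ := κ n (Preorder.frestrictLe n ω))]
      refine lintegral_congr fun t => ?_
      exact Set.indicator_of_notMem (s := Prod.fst ⁻¹' S) (fun h' => h ((hmem ω).1 h')) _
  simp_rw [e1, e2] at h1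
  exact h1.symm

/-- Before regeneration the split chain moves by the killed kernel. -/
lemma lintegral_alive (x : ℝ) (n : ℕ) {g : ℝ × Bool → ℝ≥0∞} (hg : Measurable g) :
    ∫⁻ ω, (R.alive n).indicator (fun ω => g (ω n)) ω ∂(R.pathLaw x)
      = ∫⁻ y, ∫⁻ b, g (y, b) ∂(bernoulliMeasure true false R.δ) ∂((R.killed ^ n) x) := by
  induction n generalizing g with
  | zero =>
    rw [lintegral_pow_zero _ _ hg.lintegral_prod_right', ← R.lintegral_pathLaw_zero x hg]
    simp [alive]
  | succ n ih =>
    have hG : Measurable fun z => ∫⁻ b, g (z, b) ∂(bernoulliMeasure true false R.δ) :=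
      hg.lintegral_prod_right'
    have hmeas : Measurable fun s => ∫⁻ t, g t ∂(R.splitKernel s) := hg.lintegral_kernel
    rw [R.lintegral_pathLaw_succ x n hg, lintegral_pow_succ' _ _ _ hG]
    simp_rw [← lintegral_bernoulliMeasure_splitLaw, ← R.lintegral_splitKernel _ hg]
    rw [← ih (hmeas.indicator R.measurableSet_regen.compl)]
    congr 1
    funext ω
    by_cases h1 : ω ∈ R.alive n
    · by_cases h2 : (ω n).1 ∈ R.C ∧ (ω n).2 = true
      · have h3 : ω ∉ R.alive (n + 1) := fun h => h n (Nat.lt_succ_self n) h2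
        rw [Set.indicator_of_notMem h3, Set.indicator_of_mem h1, Set.indicator_of_notMem]
        exact fun h => h h2
      · have h3 : ω ∈ R.alive (n + 1) := fun k hk => by
          rcases Nat.lt_succ_iff_lt_or_eq.1 hk with hk | rfl
          · exact h1 k hk
          · exact h2
        rw [Set.indicator_of_mem h3, Set.indicator_of_mem h1, Set.indicator_of_mem]
        exact h2
    · have h3 : ω ∉ R.alive (n + 1) := fun h => h1 fun k hk => h k (by omega)
      rw [Set.indicator_of_notMem h3, Set.indicator_of_notMem h1]

lemma meanExceedances_eq (u x : ℝ) :
    R.meanExceedances u x = ∑' n, (R.killed ^ n) x (Set.Ioi u) := by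
  classical
  have hg : Measurable fun s : ℝ × Bool => (Set.Ioi u).indicator (1 : ℝ → ℝ≥0∞) s.1 :=
    (measurable_one.indicator measurableSet_Ioi).comp measurable_fst
  have h : ∀ (n : ℕ) ω, (if (n : ℕ∞) < R.regenTime ω ∧ u < (ω n).1 then (1 : ℝ≥0∞) else 0)
      = (R.alive n).indicator (fun ω => (Set.Ioi u).indicator (1 : ℝ → ℝ≥0∞) (ω n).1) ω := by
    intro n ω
    by_cases h1 : ω ∈ R.alive n <;> by_cases h2 : u < (ω n).1 <;>
      simp [R.lt_regenTime_iff, h1, h2]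
  simp only [meanExceedances, exceedances, h]
  rw [lintegral_tsum fun n => by
    exact ((hg.comp (measurable_pi_apply n)).indicator (R.measurableSet_alive n)).aemeasurable]
  refine tsum_congr fun n => ?_
  rw [R.lintegral_alive x n hg]
  simp [lintegral_indicator_one measurableSet_Ioi]

end Minorization

section Tannery

lemma tendsto_tsum_min {f : ℝ → ℕ → ℝ≥0∞} {F g : ℕ → ℝ≥0∞} (hg : ∑' n, g n ≠ ⊤)
    (hF : ∀ n, F n ≤ g n) (h : ∀ n, Tendsto (fun u => f u n) atTop (𝓝 (F n))) :
    Tendsto (fun u => ∑' n, min (f u n) (g n)) atTop (𝓝 (∑' n, F n)) := by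
  simp_rw [← lintegral_count]
  refine tendsto_lintegral_filter_of_dominated_convergence g
    (Eventually.of_forall fun u => Measurable.of_discrete)
    (Eventually.of_forall fun u => ae_of_all _ fun n => min_le_right _ _)
    (by rwa [lintegral_count]) (ae_of_all _ fun n => ?_)
  have := (h n).min (tendsto_const_nhds (x := g n))
  rwa [min_eq_left (hF n)] at this

/-- Dominated convergence of series up to a summable error that vanishes in the limit. -/
lemma tendsto_tsum_of_le_add {f e : ℝ → ℕ → ℝ≥0∞} {F g : ℕ → ℝ≥0∞} (hg : ∑' n, g n ≠ ⊤)
    (hF : ∀ n, F n ≤ g n) (h : ∀ n, Tendsto (fun u => f u n) atTop (𝓝 (F n)))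
    (hfe : ∀ᶠ u in atTop, ∀ n, f u n ≤ g n + e u n)
    (he : Tendsto (fun u => ∑' n, e u n) atTop (𝓝 0)) :
    Tendsto (fun u => ∑' n, f u n) atTop (𝓝 (∑' n, F n)) := by
  have h1 := tendsto_tsum_min hg hF h
  have h2 := h1.add he
  rw [add_zero] at h2
  refine tendsto_of_tendsto_of_tendsto_of_le_of_le' h1 h2
    (Eventually.of_forall fun u => ENNReal.tsum_le_tsum fun n => min_le_left _ _) ?_
  filter_upwards [hfe] with u hu
  rw [← ENNReal.tsum_add]
  refine ENNReal.tsum_le_tsum fun n => ?_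
  rw [← min_add_add_right]
  exact le_min le_self_add (hu n)

end Tannery

lemma tsum_geometric_ne_top {c r : ℝ≥0∞} (hc : c ≠ ⊤) (hr : r < 1) : ∑' n : ℕ, c * r ^ n ≠ ⊤ := by
  rw [ENNReal.tsum_mul_left, ENNReal.tsum_geometric]
  exact ENNReal.mul_ne_top hc (ENNReal.inv_ne_top.2 (tsub_pos_of_lt hr).ne')

variable {μ : Measure (ℝ × ℝ × ℝ)} [IsProbabilityMeasure μ]

lemma renewalU_lt_top {ξ : ℝ} (hA : ∀ᵐ y ∂μ, 0 < y.1) (h1 : H1 μ ξ) (z : ℝ) : renewalU μ z < ⊤ := by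
  have hα : 0 < ξ / 2 := half_pos h1.pos
  refine lt_of_le_of_lt (ENNReal.tsum_le_tsum fun n => convPow_Iio_le hA hα.le n z) ?_
  exact (tsum_geometric_ne_top ENNReal.ofReal_ne_top
    (h1.slopeMoment_lt_one hA hα (half_lt_self h1.pos))).lt_top

namespace Minorization

variable (R : Minorization (letacKernel μ))

lemma killed_pow_Ioi_le (hA : ∀ᵐ y ∂μ, 0 < y.1) {α : ℝ} (hα : 0 < α) (hα1 : α ≤ 1) {u v : ℝ}
    (hu : 0 < u) (hv : 0 < v) (n : ℕ) :
    (R.killed ^ n) (v * u) (Set.Ioi u) ≤ ENNReal.ofReal (v ^ α) * slopeMoment μ α ^ n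
      + ENNReal.ofReal (u ^ (-α)) * R.inputSum (slopeMoment μ α) (inputMoment μ α) (v * u) n := by
  have hsub : Set.Ioi u ⊆ {y | ENNReal.ofReal (u ^ α) ≤ absPow α y} := by
    intro y hy
    have hy' : u < y := hy
    refine ENNReal.ofReal_le_ofReal (Real.rpow_le_rpow hu.le ?_ hα.le)
    rw [abs_of_pos (hu.trans hy')]
    exact hy'.le
  have hone : ENNReal.ofReal (u ^ (-α)) * ENNReal.ofReal (u ^ α) = 1 := by
    rw [← ENNReal.ofReal_mul (by positivity), ← Real.rpow_add hu]
    simp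
  have hvu : ENNReal.ofReal (u ^ (-α)) * absPow α (v * u) = ENNReal.ofReal (v ^ α) := by
    rw [absPow, abs_of_pos (by positivity), Real.mul_rpow hv.le hu.le, mul_comm (v ^ α),
      ENNReal.ofReal_mul (by positivity), ← mul_assoc, hone, one_mul]
  calc (R.killed ^ n) (v * u) (Set.Ioi u)
      = ENNReal.ofReal (u ^ (-α)) * (ENNReal.ofReal (u ^ α) * (R.killed ^ n) (v * u) (Set.Ioi u)) := by
        rw [← mul_assoc, hone, one_mul]
    _ ≤ ENNReal.ofReal (u ^ (-α)) * ∫⁻ y, absPow α y ∂((R.killed ^ n) (v * u)) := by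
        gcongr
        exact (mul_le_mul_right (measure_mono hsub) _).trans
          (mul_meas_ge_le_lintegral (measurable_absPow α) _)
    _ ≤ ENNReal.ofReal (u ^ (-α)) * (slopeMoment μ α ^ n * absPow α (v * u)
        + R.inputSum (slopeMoment μ α) (inputMoment μ α) (v * u) n) := by
        gcongr
        exact R.lintegral_killed_pow_le (measurable_absPow α)
          (fun x => lintegral_absPow_letacKernel_le hA hα hα1 x) n _
    _ = _ := by
        rw [mul_add, mul_left_comm, hvu, mul_comm (slopeMoment μ α ^ n)]

lemma tendsto_rpow_neg_mul_tsum_inputSum {ξ : ℝ} (hA : ∀ᵐ y ∂μ, 0 < y.1) (h1 : H1 μ ξ)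
    (h2 : H2 μ ξ) {α : ℝ} (hα : 0 < α) (hα1 : α ≤ 1) (hαξ : α < ξ) {v : ℝ} (hv : 0 < v) :
    Tendsto (fun u : ℝ => ∑' n, ENNReal.ofReal (u ^ (-α))
      * R.inputSum (slopeMoment μ α) (inputMoment μ α) (v * u) n) atTop (𝓝 0) := by
  obtain ⟨c, hc, hsum⟩ := R.exists_tsum_killed_pow_univ_le hA h1 h2 (half_pos hα)
    (by linarith) (by linarith : α / 2 < ξ)
  set k := inputMoment μ α * (1 - slopeMoment μ α)⁻¹ with hk
  have hβ := h1.slopeMoment_lt_one hA hα hαξ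
  have hkfin : k ≠ ⊤ := ENNReal.mul_ne_top (h2.inputMoment_lt_top hA hα.le hαξ.le).ne
    (ENNReal.inv_ne_top.2 (tsub_pos_of_lt hβ).ne')
  have t1 : Tendsto (fun u : ℝ => ENNReal.ofReal (v ^ (α / 2) * u ^ (-(α / 2)))) atTop (𝓝 0) := by
    rw [← ENNReal.ofReal_zero]
    refine ENNReal.tendsto_ofReal ?_
    simpa using (tendsto_rpow_neg_atTop (half_pos hα)).const_mul (v ^ (α / 2))
  have t2 : Tendsto (fun u : ℝ => ENNReal.ofReal (u ^ (-α)) * c) atTop (𝓝 0) := by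
    have := ENNReal.Tendsto.mul_const (b := c)
      (ENNReal.tendsto_ofReal (tendsto_rpow_neg_atTop hα)) (Or.inr hc.ne)
    simpa using this
  have t3 := ENNReal.Tendsto.const_mul (a := k) (t1.add t2) (Or.inr hkfin)
  rw [add_zero, mul_zero] at t3
  refine tendsto_of_tendsto_of_tendsto_of_le_of_le' tendsto_const_nhds t3
    (Eventually.of_forall fun _ => zero_le) ?_
  filter_upwards [eventually_gt_atTop 0] with u hu
  rw [ENNReal.tsum_mul_left]
  calc _ ≤ ENNReal.ofReal (u ^ (-α)) * (k * (absPow (α / 2) (v * u) + c)) := by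
        gcongr
        exact (R.tsum_inputSum_le hβ _).trans (by gcongr; exact hsum _)
    _ = k * (ENNReal.ofReal (u ^ (-α)) * absPow (α / 2) (v * u)
        + ENNReal.ofReal (u ^ (-α)) * c) := by ring
    _ = _ := by
        congr 3
        rw [absPow, abs_of_pos (by positivity), ← ENNReal.ofReal_mul (by positivity),
          Real.mul_rpow hv.le hu.le, mul_left_comm, ← Real.rpow_add hu]
        congr 3
        ring

end Minorization

end LetacE

/-- Letac's Model E, `V_n = A_n max(D_n, V_{n-1}) + B_n`, under `(H₁)`, `(H₂)`, `(H₃)`: for every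
`v > 1` such that `log v` is not an atom of a convolution power of the law of `-log A`,
`E[N_u | V_0 / u = v] → U(log v) < ∞` as `u → ∞`. -/
theorem theorem4p1 (μ : Measure (ℝ × ℝ × ℝ)) [IsProbabilityMeasure μ]
    (hA : ∀ᵐ y ∂μ, 0 < y.1) (ξ : ℝ)
    (h1 : LetacE.H1 μ ξ) (h2 : LetacE.H2 μ ξ) (h3 : LetacE.H3 μ)
    (R : LetacE.Minorization (LetacE.letacKernel μ))
    (v : ℝ) (hv : 1 < v)
    (hatom : ∀ n : ℕ, LetacE.convPow (LetacE.negLogLaw μ) n {Real.log v} = 0) :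
    LetacE.renewalU μ (Real.log v) < ⊤ ∧
      Tendsto (fun u : ℝ => R.meanExceedances u (v * u)) atTop
        (𝓝 (LetacE.renewalU μ (Real.log v))) := by
  have hv0 : 0 < v := one_pos.trans hv
  refine ⟨LetacE.renewalU_lt_top hA h1 _, ?_⟩
  obtain ⟨α, hα, hαm⟩ := exists_between (lt_min one_pos h1.pos)
  have hα1 : α ≤ 1 := (hαm.trans_le (min_le_left _ _)).le
  have hαξ : α < ξ := hαm.trans_le (min_le_right _ _)
  simp_rw [R.meanExceedances_eq]
  refine LetacE.tendsto_tsum_of_le_add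
    (g := fun n => ENNReal.ofReal (v ^ α) * LetacE.slopeMoment μ α ^ n)
    (LetacE.tsum_geometric_ne_top ENNReal.ofReal_ne_top (h1.slopeMoment_lt_one hA hα hαξ))
    (fun n => ?_) (fun n => R.tendsto_killed_pow_Ioi hA n hv0 (hatom n)) ?_
    (R.tendsto_rpow_neg_mul_tsum_inputSum hA h1 h2 hα hα1 hαξ hv0)
  · refine (LetacE.convPow_Iio_le hA hα.le n _).trans_eq ?_
    rw [Real.rpow_def_of_pos hv0, mul_comm α]
  · filter_upwards [eventually_gt_atTop 0] with u hu n
    exact R.killed_pow_Ioi_le hA hα hα1 hu hv0 n
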